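/- **Setting.** Let $M_1,\dots,M_m$ be germs at $0$ of real analytic totally real $n$-dimensional submanifolds of $\mathbb C^n$ through the origin. Each $M_i$ is, near $0$, the fixed point set of a germ of anti-holomorphic involution $\rho_i(z)=B_i\bar z+R_i(\bar z)$, where $\rho_i\circ\rho_i=\mathrm{Id}$ and $R_i$ is a germ of holomorphic map with $R_i(0)=0$, $DR_i(0)=0$. Let $G$ be the group of germs of biholomorphisms generated by $F_{i,j}:=\rho_i\circ\rho_j$, $1\le i,j\le m$, and let $D:=\{D_{i,j}\}$, where $D_{i,j}=B_i\bar B_j$ is the linear part of $F_{i,j}$ at $0$. Assume that $G$ is abelian and that all the $D_{i,j}=\mathrm{diag}(\mu_{i,j,1},\dots,\mu_{i,j,n})$ are diagonal. Let $\mathcal O_n$ be the ring of germs at $0\in\mathbb C^n$ of holomorphic functions (convergent power series), and let $\mathcal I\subset\mathcal O_n$ be an ideal generated by monomials $x^R$, $R\in A$. Let $\hat{\mathcal I}$ be the ideal generated by $\mathcal I$ in $\mathbb C[[x_1,\dots,x_n]]$, and $\bar{\mathcal I}$ the ideal generated by the monomials $\bar x^{R}$, $R\in A$, in the ring of convergent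 power series in $\bar x_1,\dots,\bar x_n$. Assume that $\mathcal I$ is left invariant by $D$ and by the involutions $z\mapsto B_i\bar z$: for $f\in\mathcal I$ one has $f(D_{i,j}z)\in\mathcal I$ and $f(B_i\bar z)\in\bar{\mathcal I}$. The ideal $\mathcal I$ is *properly embedded* if it has a set of monomial generators that does not involve all the variables. For $Q\in\mathbb N^n$ put $|Q|=q_1+\dots+q_n$ and $\mu_{i,j}^Q=\prod_l\mu_{i,j,l}^{q_l}$. * *Diophantine.* Let $$\omega_k(D,\mathcal I)=\inf\Big\{\max_{i,j}|\mu_{i,j}^Q-\mu_{i,j,s}|\neq0\ :\ 2\le|Q|\le2^k,\ 1\le s\le n,\ x^Q\notin\mathcal I\Big\},$$ and let $\omega_k(D)$ be defined in the same way without the condition $x^Q\notin\mathcal I$. $D$ is diophantine (resp. diophantine on $\mathcal I$) if $-\sum_{k\ge1}2^{-k}\ln\omega_k(D)<+\infty$ (resp. $-\sum_{k\ge1}2^{-k}\ln\omega_k(D,\mathcal I)<+\infty$), where the indices $k$ for which the infimum is over the empty set are omitted. * *Non-resonant on $\mathcal I$.* For every $Q\in\mathbb N^n$ with $|Q|\ge2$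 and $z^Q\notin\mathcal I$, and every $1\le i\le m$, $1\le k\le n$, there is $j$ with $\bar\mu_{i,j}^{\,Q}\ne\mu_{i,j,k}^{-1}$. * *Formally linearizable on $\mathcal I$.* There is a formal diffeomorphism $\hat\Phi$ of $(\mathbb C^n,0)$, tangent to the identity at $0$, such that $\hat\Phi\circ g\circ\hat\Phi^{-1}-Dg(0)x\in\hat{\mathcal I}^{\,n}$ for all $g\in G$, and such that the coefficient of $x^Q$ in the $k$-th component of $\hat\Phi$ is zero whenever $|Q|\ge2$ and $\mu_{i,j}^Q=\mu_{i,j,k}$ for all $i,j$ (that is, $\hat\Phi$ has zero projection on the nonlinear formal centralizer of $D$). **Theorem.** Assume that $D$ is diophantine, or that $\mathcal I$ is properly embedded and $D$ is diophantine on $\mathcal I$. Assume that $M=\{M_i\}$ is non-resonant on $\mathcal I$ and that $G$ is formally linearizable on $\mathcal I$. Then $G$ is holomorphically linearizable on $\mathcal I$, and in the linearizing coordinates the $\rho_i$ are anti-linear modulo $\bar{\mathcal I}$: there is a germ of biholomorphism $\Phi$ of $(\mathbb C^n,0)$, tangent to the identity at $0$, such that $$\Phi\circ g\circ\Phi^{-1}-Dg(0)x\in\mathcal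 I^{\,n}\quad\text{for all }g\in G,\qquad \Phi\circ\rho_i\circ\Phi^{-1}(z)-B_i\bar z\in\bar{\mathcal I}^{\,n}\quad\text{for }1\le i\le m.$$ -/

import Mathlib

open Filter Topology

noncomputable section

namespace TotallyReal

/-! ### Formal and convergent power series in `n` complex variables

A germ at `0 ∈ ℂⁿ` of a holomorphic function is identified with its Taylor series, i.e. with a
convergent power series. -/

/-- The ring of formal power series `ℂ[[x₁, …, xₙ]]`. -/
abbrev Formal (n : ℕ) : Type := MvPowerSeries (Fin n) ℂ

/-- `f` converges (absolutely) on some polydisc of positive radius. -/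
def IsConvergent {n : ℕ} (f : Formal n) : Prop :=
  ∃ r : ℝ, 0 < r ∧
    Summable fun Q : Fin n →₀ ℕ => ‖MvPowerSeries.coeff Q f‖ * r ^ Q.degree

theorem IsConvergent.mono_radius {n : ℕ} {f : Formal n} {r s : ℝ} (hr : 0 ≤ r) (hrs : r ≤ s)
    (h : Summable fun Q : Fin n →₀ ℕ => ‖MvPowerSeries.coeff Q f‖ * s ^ Q.degree) :
    Summable fun Q : Fin n →₀ ℕ => ‖MvPowerSeries.coeff Q f‖ * r ^ Q.degree := by
  refine Summable.of_nonneg_of_le (fun Q => by positivity) (fun Q => ?_) h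
  gcongr

theorem isConvergent_monomial {n : ℕ} (Q : Fin n →₀ ℕ) (c : ℂ) :
    IsConvergent (MvPowerSeries.monomial Q c : Formal n) := by
  classical
  refine ⟨1, one_pos, summable_of_ne_finset_zero (s := {Q}) fun P hP => ?_⟩
  rw [Finset.mem_singleton] at hP
  rw [MvPowerSeries.coeff_monomial_ne hP]
  simp

theorem IsConvergent.add {n : ℕ} {f g : Formal n} (hf : IsConvergent f) (hg : IsConvergent g) :
    IsConvergent (f + g) := by
  obtain ⟨r, hr, hfr⟩ := hf
  obtain ⟨s, hs, hgs⟩ := hg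
  have ht : 0 < min r s := lt_min hr hs
  refine ⟨min r s, ht, ?_⟩
  have h := (IsConvergent.mono_radius ht.le (min_le_left r s) hfr).add
    (IsConvergent.mono_radius ht.le (min_le_right r s) hgs)
  refine Summable.of_nonneg_of_le (fun Q => by positivity) (fun Q => ?_) h
  rw [map_add, ← add_mul]
  gcongr
  exact norm_add_le _ _

theorem IsConvergent.mul {n : ℕ} {f g : Formal n} (hf : IsConvergent f) (hg : IsConvergent g) :
    IsConvergent (f * g) := by
  classical
  obtain ⟨r, hr, hfr⟩ := hf
  obtain ⟨s, hs, hgs⟩ := hg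
  obtain ⟨t, ht, htr, hts⟩ : ∃ t : ℝ, 0 < t ∧ t ≤ r ∧ t ≤ s :=
    ⟨min r s, lt_min hr hs, min_le_left r s, min_le_right r s⟩
  refine ⟨t, ht, ?_⟩
  have h1 := IsConvergent.mono_radius ht.le htr hfr
  have h2 := IsConvergent.mono_radius ht.le hts hgs
  set F : (Fin n →₀ ℕ) → ℝ := fun Q => ‖MvPowerSeries.coeff Q f‖ * t ^ Q.degree with hF
  set G : (Fin n →₀ ℕ) → ℝ := fun Q => ‖MvPowerSeries.coeff Q g‖ * t ^ Q.degree with hG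
  have hF0 : 0 ≤ F := fun Q => mul_nonneg (norm_nonneg _) (pow_nonneg ht.le _)
  have hG0 : 0 ≤ G := fun Q => mul_nonneg (norm_nonneg _) (pow_nonneg ht.le _)
  have h : Summable fun Q => ∑ p ∈ Finset.HasAntidiagonal.antidiagonal Q, F p.1 * G p.2 :=
    summable_sum_mul_antidiagonal_of_summable_mul (h1.mul_of_nonneg h2 hF0 hG0)
  refine Summable.of_nonneg_of_le
    (fun Q => mul_nonneg (norm_nonneg _) (pow_nonneg ht.le _)) (fun Q => ?_) h
  rw [MvPowerSeries.coeff_mul]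
  refine (mul_le_mul_of_nonneg_right (norm_sum_le _ _) (pow_nonneg ht.le _)).trans ?_
  rw [Finset.sum_mul]
  refine Finset.sum_le_sum fun p hp => ?_
  have hQ : Q.degree = p.1.degree + p.2.degree := by
    rw [← Finset.HasAntidiagonal.mem_antidiagonal.mp hp, map_add]
  rw [hQ, pow_add, norm_mul]
  exact le_of_eq (mul_mul_mul_comm _ _ _ _)

/-- The ring `𝒪ₙ` of convergent power series (germs at `0 ∈ ℂⁿ` of holomorphic functions). -/
def Holo (n : ℕ) : Subalgebra ℂ (Formal n) where
  carrier := {f | IsConvergent f}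
  add_mem' := IsConvergent.add
  mul_mem' := IsConvergent.mul
  algebraMap_mem' c := isConvergent_monomial 0 c

/-- The monomial `x^Q` as an element of `𝒪ₙ`. -/
def mono {n : ℕ} (Q : Fin n →₀ ℕ) : Holo n :=
  ⟨MvPowerSeries.monomial Q 1, isConvergent_monomial Q 1⟩

/-- The value at `z` of a power series. -/
def eval {n : ℕ} (f : Formal n) (z : Fin n → ℂ) : ℂ :=
  ∑' Q : Fin n →₀ ℕ, MvPowerSeries.coeff Q f * ∏ l, z l ^ Q l

/-! ### Maps

A germ of holomorphic (or formal) map `g : (ℂⁿ, 0) → ℂⁿ` is given by its `n` components.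
An anti-holomorphic germ `z ↦ S(z̄)` is represented by the tuple `S`. -/

/-- An `n`-tuple of formal power series in `n` variables. -/
abbrev FormalMap (n : ℕ) : Type := Fin n → Formal n

/-- The formal map underlying an `n`-tuple of convergent power series. -/
def toFormal {n : ℕ} (g : Fin n → Holo n) : FormalMap n := fun k => (g k : Formal n)

/-- The identity map `x ↦ x`. -/
def idMap (n : ℕ) : FormalMap n := fun k => MvPowerSeries.X k

/-- The composition `g ∘ h` (for `h(0) = 0`). -/
def comp {n : ℕ} (g h : FormalMap n) : FormalMap n := fun k => MvPowerSeries.subst h (g k)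

/-- Complex conjugation of all the coefficients, `ḡ(x) = conj (g (conj x))`. -/
def conjMap {n : ℕ} (g : FormalMap n) : FormalMap n :=
  fun k => MvPowerSeries.map (starRingEnd ℂ) (g k)

/-- The linear part at the origin. -/
def linearPart {n : ℕ} (g : FormalMap n) : Matrix (Fin n) (Fin n) ℂ :=
  Matrix.of fun k l => MvPowerSeries.coeff (Finsupp.single l 1) (g k)

/-- The linear map `x ↦ A x`. -/
def linearMap {n : ℕ} (A : Matrix (Fin n) (Fin n) ℂ) : FormalMap n :=
  fun k => ∑ l, A k l • (MvPowerSeries.X l : Formal n)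

/-- `g(0) = 0` and the linear part of `g` is the identity. -/
def IsTangentToId {n : ℕ} (g : FormalMap n) : Prop :=
  (∀ k, MvPowerSeries.constantCoeff (g k) = 0) ∧ linearPart g = 1

/-- `h` is the inverse of `g` for the composition. -/
def IsInverse {n : ℕ} (g h : FormalMap n) : Prop :=
  comp g h = idMap n ∧ comp h g = idMap n

/-! ### Totally real submanifolds and anti-holomorphic involutions -/

/-- Near `0`, the set `M` is a real analytic submanifold of `ℂⁿ` through `0`, of real dimension `n`
and totally real: it is the zero set of a real analytic submersion `r` to `ℝⁿ`, and the tangent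
space `T = ker dr(0)` satisfies `T ∩ iT = 0`. -/
def IsTotallyRealGerm {n : ℕ} (M : Set (Fin n → ℂ)) : Prop :=
  ∃ r : (Fin n → ℂ) → (Fin n → ℝ),
    AnalyticAt ℝ r 0 ∧ r 0 = 0 ∧ Function.Surjective (fderiv ℝ r 0) ∧
    (∀ v, fderiv ℝ r 0 v = 0 → fderiv ℝ r 0 (Complex.I • v) = 0 → v = 0) ∧
    ∀ᶠ z in 𝓝 (0 : Fin n → ℂ), z ∈ M ↔ r z = 0

/-- The anti-holomorphic germ `ρ(z) = S(z̄)` fixes `0` and is an involution: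
`ρ(ρ(z)) = S(conj (S(z̄))) = (S ∘ S̄)(z) = z`. -/
def IsAntiInvolution {n : ℕ} (S : Fin n → Holo n) : Prop :=
  (∀ k, MvPowerSeries.constantCoeff (toFormal S k) = 0) ∧
    comp (toFormal S) (conjMap (toFormal S)) = idMap n

/-- Near `0`, the set `M` is the fixed point set of `ρ(z) = S(z̄)`. -/
def IsFixedSet {n : ℕ} (S : Fin n → Holo n) (M : Set (Fin n → ℂ)) : Prop :=
  ∀ᶠ z in 𝓝 (0 : Fin n → ℂ),
    z ∈ M ↔ ∀ k, eval (toFormal S k) (fun l => starRingEnd ℂ (z l)) = z k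

/-- The matrix `B` of `ρ(z) = B z̄ + R(z̄)`. -/
def antiLinearPart {n : ℕ} (S : Fin n → Holo n) : Matrix (Fin n) (Fin n) ℂ :=
  linearPart (toFormal S)

/-- The holomorphic germ `F_{ij} = ρ_i ∘ ρ_j`, that is `S_i ∘ S̄_j`. -/
def pairMap {n m : ℕ} (S : Fin m → Fin n → Holo n) (i j : Fin m) : FormalMap n :=
  comp (toFormal (S i)) (conjMap (toFormal (S j)))

/-- The linear part `D_{ij} = B_i B̄_j` of `F_{ij}`. -/
def pairLinear {n m : ℕ} (S : Fin m → Fin n → Holo n) (i j : Fin m) :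
    Matrix (Fin n) (Fin n) ℂ :=
  antiLinearPart (S i) * (antiLinearPart (S j)).map (starRingEnd ℂ)

/-- The diagonal entries `μ_{ij,k}` of the matrices `D_{ij}`. -/
def eigenvalue {n m : ℕ} (S : Fin m → Fin n → Holo n) (p : Fin m × Fin m) (k : Fin n) : ℂ :=
  pairLinear S p.1 p.2 k k

/-- Membership in the group `G` generated by the `F_{ij}`. Since the `ρ_i` are involutions,
`F_{ij}⁻¹ = F_{ji}`, so that all elements of the group are products of generators. -/
inductive MemGroup {n m : ℕ} (S : Fin m → Fin n → Holo n) : FormalMap n → Prop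
  | one : MemGroup S (idMap n)
  | mul (i j : Fin m) (g : FormalMap n) : MemGroup S g → MemGroup S (comp (pairMap S i j) g)

/-! ### Monomial ideals, invariance, small divisors -/

/-- The ideal `I` of `𝒪ₙ` is generated by the monomials with exponents in `A`. -/
def IsMonomialSpan {n : ℕ} (I : Ideal (Holo n)) (A : Set (Fin n →₀ ℕ)) : Prop :=
  I = Ideal.span (mono '' A)

/-- `I` is generated by monomials. -/
def IsMonomialIdeal {n : ℕ} (I : Ideal (Holo n)) : Prop :=
  ∃ A : Set (Fin n →₀ ℕ), IsMonomialSpan I A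

/-- `I` has a set of monomial generators that does not involve all variables. -/
def IsProperlyEmbedded {n : ℕ} (I : Ideal (Holo n)) : Prop :=
  ∃ A : Set (Fin n →₀ ℕ), IsMonomialSpan I A ∧ ∃ s : Fin n, ∀ R ∈ A, R s = 0

/-- The power series `f` is (convergent and) an element of `I`. -/
def MemIdeal {n : ℕ} (I : Ideal (Holo n)) (f : Formal n) : Prop :=
  ∃ h : Holo n, h ∈ I ∧ (h : Formal n) = f

/-- The ideal `Î` of the ring of formal power series generated by `I`. -/
def formalIdeal {n : ℕ} (I : Ideal (Holo n)) : Ideal (Formal n) :=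
  I.map (Holo n).val

/-- `f ↦ f(A x)` maps `I` to itself. Applied to `A = B`, it says that `f ↦ f(B z̄)` maps `I` to `Ī`:
a series in `z̄` is represented by the same series in `x`, and `Ī`, generated by the `z̄^R`, by
the ideal `I`, generated by the `x^R`. -/
def IsInvariantUnder {n : ℕ} (I : Ideal (Holo n)) (A : Matrix (Fin n) (Fin n) ℂ) : Prop :=
  ∀ f ∈ I, MemIdeal I (MvPowerSeries.subst (linearMap A) (f : Formal n))

/-- `μ^Q = μ₁^{q₁} ⋯ μₙ^{qₙ}`. -/
def powQ {n : ℕ} (μ : Fin n → ℂ) (Q : Fin n →₀ ℕ) : ℂ := ∏ l, μ l ^ Q l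

/-- `max_p |μ_p^Q - μ_{p,j}|` over the finite family `μ`. -/
def maxDivisor {ι : Type} [Fintype ι] {n : ℕ} (μ : ι → Fin n → ℂ) (Q : Fin n →₀ ℕ)
    (j : Fin n) : ℝ :=
  ⨆ p, ‖powQ (μ p) Q - μ p j‖

/-- `ω_k`: the least nonzero value of `max_p |μ_p^Q - μ_{p,j}|` for `2 ≤ |Q| ≤ 2^k`, `Q ∈ E`.
If there is no such value, `ω_k = 0` here, and `Real.log 0 = 0`, so that `k` does not contribute to
the series below. -/
def omega {ι : Type} [Fintype ι] {n : ℕ} (μ : ι → Fin n → ℂ) (E : Set (Fin n →₀ ℕ))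
    (k : ℕ) : ℝ :=
  sInf {d : ℝ | d ≠ 0 ∧ ∃ (Q : Fin n →₀ ℕ) (j : Fin n),
    2 ≤ Q.degree ∧ Q.degree ≤ 2 ^ k ∧ Q ∈ E ∧ d = maxDivisor μ Q j}

/-- `-∑_{k ≥ 1} ln ω_k / 2^k < +∞`. The sequence `-ln ω_k` is eventually constant zero or
nondecreasing, so the series has a sum in `(-∞, +∞]`, and the condition is summability. -/
def IsDiophantine {ι : Type} [Fintype ι] {n : ℕ} (μ : ι → Fin n → ℂ)
    (E : Set (Fin n →₀ ℕ)) : Prop :=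
  Summable fun k : ℕ => -Real.log (omega μ E (k + 1)) / 2 ^ (k + 1)

/-- The exponents of the monomials that do not belong to `I`. -/
def exponentsOff {n : ℕ} (I : Ideal (Holo n)) : Set (Fin n →₀ ℕ) := {Q | mono Q ∉ I}

/-- For every monomial `z^Q ∉ I`, `|Q| ≥ 2`, and every couple `(i, k)`, there is `j` with
`conj(μ_{ij})^Q ≠ μ_{ij,k}⁻¹`. -/
def IsNonResonantOn {n m : ℕ} (S : Fin m → Fin n → Holo n) (I : Ideal (Holo n)) : Prop :=
  ∀ Q : Fin n →₀ ℕ, 2 ≤ Q.degree → mono Q ∉ I → ∀ (i : Fin m) (k : Fin n), ∃ j : Fin m,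
    powQ (fun l => starRingEnd ℂ (eigenvalue S (i, j) l)) Q ≠ (eigenvalue S (i, j) k)⁻¹

/-! ### Linearizability on an ideal -/

/-- The projection of `Φ` on the nonlinear centralizer of the diagonal family `μ` vanishes. This
centralizer consists of the series in the vector monomials `x^Q e_k`, `|Q| ≥ 2`, that commute with
the family, i.e. `μ_p^Q = μ_{p,k}` for all `p`. -/
def HasZeroProjection {ι : Type} {n : ℕ} (μ : ι → Fin n → ℂ) (Φ : FormalMap n) : Prop :=
  ∀ (Q : Fin n →₀ ℕ) (k : Fin n), 2 ≤ Q.degree → (∀ p, powQ (μ p) Q = μ p k) →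
    MvPowerSeries.coeff Q (Φ k) = 0

/-- `G` is formally linearizable on `Î`: there is a formal diffeomorphism `Φ` tangent to the
identity, with zero projection on the nonlinear centralizer, such that the components of
`Φ ∘ g ∘ Φ⁻¹ - Dg(0)` are in `Î` for all `g` in `G`. -/
def IsFormallyLinearizableOn {n m : ℕ} (S : Fin m → Fin n → Holo n) (I : Ideal (Holo n)) :
    Prop :=
  ∃ Φ Ψ : FormalMap n, IsTangentToId Φ ∧ IsInverse Φ Ψ ∧
    (∀ k, MvPowerSeries.constantCoeff (Ψ k) = 0) ∧ HasZeroProjection (eigenvalue S) Φ ∧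
    ∀ g, MemGroup S g → ∀ k,
      comp Φ (comp g Ψ) k - linearMap (linearPart g) k ∈ formalIdeal I

/-- The germ of biholomorphism `Φ`, with inverse `Ψ`, linearizes `G` on `I`: the components of
`Φ ∘ g ∘ Φ⁻¹ - Dg(0)` are in `I` for all `g` in `G`. -/
def LinearizesGroupOn {n m : ℕ} (S : Fin m → Fin n → Holo n) (I : Ideal (Holo n))
    (Φ Ψ : Fin n → Holo n) : Prop :=
  ∀ g, MemGroup S g → ∀ k,
    MemIdeal I (comp (toFormal Φ) (comp g (toFormal Ψ)) k - linearMap (linearPart g) k)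

/-- `Φ ∘ ρ ∘ Φ⁻¹ (z) = B z̄` modulo `Ī`, for `ρ(z) = S(z̄)` with linear part `B z̄`. The left-hand
side is `(Φ ∘ S ∘ Ψ̄)(z̄)`, where `Ψ = Φ⁻¹`. -/
def LinearizesInvolutionOn {n : ℕ} (S : Fin n → Holo n) (I : Ideal (Holo n))
    (Φ Ψ : Fin n → Holo n) : Prop :=
  ∀ k, MemIdeal I
    (comp (toFormal Φ) (comp (toFormal S) (conjMap (toFormal Ψ))) k
      - linearMap (antiLinearPart S) k)

end TotallyReal

end

/-!
Let `U` be the set of the exponents `Q` with `x^Q ∈ I`. Modulo `I` only the coefficients with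
exponents outside `U` matter, and a convergent series with all exponents in `U` belongs to `I`
(`memIdeal_of_mem_suppIdeal`).

The non-resonance condition on the involutions `ρ_i(z) = B_i z̄ + ⋯` has two uses. First, `B_i`
conjugates `D_{ij}` to `D̄_{ij}⁻¹` and preserves `I`, which turns the condition into: no `Q` outside
`U` of degree at least two is resonant for all the `D_{ij}` (`exists_powQ_ne`). Second, once the
`F_{ij}` are linear modulo `I`, the relation `F_{ij} ρ_i F_{ij} = ρ_i` forces `ρ_i` to be antilinear
modulo `I` (`sub_linearMap_mem_of_conjugation`).

The group is linearized through the inverse `Ψ` of the linearizing map, which has to satisfy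
`F_p ∘ Ψ ≡ Ψ ∘ D_p` modulo `I` for all pairs `p`. A formal solution comes from the hypothesis, and
its terms in `I` of degree at least two can be dropped (`exists_formal_solution`). With
`F_p = D_p + f_p`, the remaining coefficients satisfy `(μ_p^Q - μ_{p,k}) Ψ_{Q,k} = [f_{p,k}(Ψ)]_Q`
for every `p`. As there are no resonances, one may divide by the divisor of largest modulus.

Convergence of `Ψ` is proved by majorants with coefficients in `[0, ∞]`. Expanding the recursion
gives a sum over trees, and each coefficient is at most the coefficient of the solution without
divisors, which converges, times the largest product of inverse divisors over a tree
(`coeff_le_majorantIterate_mul_treeSup`). By Brjuno's counting argument (`DivisorTree.count_aux`),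
a tree with root `Q` has at most `2|Q|/2^k` nodes with divisors well below `ω_k`, because two such
nodes above each other differ by an exponent of degree at least `2^k`
(`IsSmall.degree_add_le`). Summing over `k`, the diophantine condition bounds these products by
`K^|Q|` (`exists_prod_divisorCost_le`). The inverse of `Ψ` converges by the same majorants without
divisors (`isConvergent_inverse`).
-/

namespace TotallyReal

open scoped ENNReal NNReal

/-! ### Series with prescribed exponents -/

/-- The ideal of the formal series all of whose exponents lie in the upper set `U`. -/
def suppIdeal {n : ℕ} (U : UpperSet (Fin n →₀ ℕ)) : Ideal (Formal n) where
  carrier := {f | ∀ Q ∉ U, MvPowerSeries.coeff Q f = 0}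
  add_mem' {f g} hf hg Q hQ := by rw [map_add, hf Q hQ, hg Q hQ, add_zero]
  zero_mem' Q _ := map_zero _
  smul_mem' g f hf Q hQ := by
    classical
    rw [smul_eq_mul, MvPowerSeries.coeff_mul]
    refine Finset.sum_eq_zero fun p hp => ?_
    have hle : p.2 ≤ Q := by
      rw [← Finset.HasAntidiagonal.mem_antidiagonal.mp hp]
      exact le_add_self
    rw [hf p.2 fun h => hQ (U.upper hle h), mul_zero]

/-- The exponents of degree at least `d`. -/
def degGE (n d : ℕ) : UpperSet (Fin n →₀ ℕ) where
  carrier := {Q | d ≤ Q.degree}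
  upper' _ _ hPQ h := le_trans h (Finsupp.degree_mono hPQ)

@[simp] theorem mem_degGE {n d : ℕ} {Q : Fin n →₀ ℕ} : Q ∈ degGE n d ↔ d ≤ Q.degree := Iff.rfl

theorem suppIdeal_mono {n : ℕ} {U V : UpperSet (Fin n →₀ ℕ)} (h : ∀ Q ∈ U, Q ∈ V) :
    suppIdeal U ≤ suppIdeal V := fun _ hf Q hQ => hf Q fun hU => hQ (h Q hU)

theorem mem_suppIdeal_degGE_one {n : ℕ} {f : Formal n} :
    f ∈ suppIdeal (degGE n 1) ↔ MvPowerSeries.constantCoeff f = 0 := by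
  refine ⟨fun h => h 0 (by simp), fun h Q hQ => ?_⟩
  have : Q = 0 := by
    rw [mem_degGE, not_le, Nat.lt_one_iff] at hQ
    exact (Finsupp.degree_eq_zero_iff Q).mp hQ
  rw [this]; exact h

theorem mul_mem_suppIdeal {n : ℕ} {U V W : UpperSet (Fin n →₀ ℕ)} {f g : Formal n}
    (hf : f ∈ suppIdeal U) (hg : g ∈ suppIdeal V) (h : ∀ P ∈ U, ∀ Q ∈ V, P + Q ∈ W) :
    f * g ∈ suppIdeal W := by
  classical
  intro Q hQ
  rw [MvPowerSeries.coeff_mul]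
  refine Finset.sum_eq_zero fun p hp => ?_
  by_cases h1 : p.1 ∈ U
  · by_cases h2 : p.2 ∈ V
    · exact absurd (Finset.HasAntidiagonal.mem_antidiagonal.mp hp ▸ h _ h1 _ h2) hQ
    · rw [hg _ h2, mul_zero]
  · rw [hf _ h1, zero_mul]

/-! ### Substitution and the ideals of monomial type -/

theorem exists_eq_single_add {n : ℕ} {P : Fin n →₀ ℕ} (hP : P ≠ 0) :
    ∃ (l : Fin n) (P' : Fin n →₀ ℕ), P = Finsupp.single l 1 + P' := by
  obtain ⟨l, hl⟩ := Finsupp.ne_iff.mp hP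
  refine ⟨l, P - Finsupp.single l 1, (add_tsub_cancel_of_le ?_).symm⟩
  rw [Finsupp.single_le_iff]
  exact Nat.one_le_iff_ne_zero.mpr hl

/-- The monomial `Θ^P = Θ₁^{p₁} ⋯ Θₙ^{pₙ}` in the components of a formal map. -/
noncomputable def mpow {n : ℕ} (Θ : FormalMap n) (P : Fin n →₀ ℕ) : Formal n :=
  P.prod fun l e => Θ l ^ e

theorem mpow_add {n : ℕ} (Θ : FormalMap n) (P Q : Fin n →₀ ℕ) :
    mpow Θ (P + Q) = mpow Θ P * mpow Θ Q :=
  Finsupp.prod_add_index' (fun _ => pow_zero _) fun _ _ _ => pow_add _ _ _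

theorem mpow_single {n : ℕ} (Θ : FormalMap n) (l : Fin n) :
    mpow Θ (Finsupp.single l 1) = Θ l := by
  simp [mpow]

theorem mpow_zero {n : ℕ} (Θ : FormalMap n) : mpow Θ 0 = 1 := Finsupp.prod_zero_index

/-- A formal map without constant term; these are the maps that can be composed. -/
def VanishesAtZero {n : ℕ} (Θ : FormalMap n) : Prop :=
  ∀ k, MvPowerSeries.constantCoeff (Θ k) = 0

theorem VanishesAtZero.hasSubst {n : ℕ} {Θ : FormalMap n} (h : VanishesAtZero Θ) :
    MvPowerSeries.HasSubst Θ := MvPowerSeries.hasSubst_of_constantCoeff_zero h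

theorem coeff_subst_eq_finsum {n : ℕ} {Θ : FormalMap n} (h : VanishesAtZero Θ) (f : Formal n)
    (Q : Fin n →₀ ℕ) :
    MvPowerSeries.coeff Q (MvPowerSeries.subst Θ f) =
      ∑ᶠ P, MvPowerSeries.coeff P f * MvPowerSeries.coeff Q (mpow Θ P) :=
  MvPowerSeries.coeff_subst h.hasSubst f Q

theorem mpow_mem_degGE {n : ℕ} {Θ : FormalMap n} (h : VanishesAtZero Θ) (P : Fin n →₀ ℕ) :
    mpow Θ P ∈ suppIdeal (degGE n P.degree) := by
  induction hd : P.degree generalizing P with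
  | zero => intro Q hQ; simp at hQ
  | succ d ih =>
    obtain ⟨l, P', rfl⟩ := exists_eq_single_add (P := P) (by rintro rfl; simp at hd)
    rw [mpow_add, mpow_single]
    rw [map_add, Finsupp.degree_single] at hd
    refine mul_mem_suppIdeal (mem_suppIdeal_degGE_one.mpr (h l)) (ih P' (by omega)) ?_
    intro A hA B hB
    rw [mem_degGE] at *
    rw [map_add]; omega

theorem mpow_sub_mpow_mem {n : ℕ} {Θ Θ' : FormalMap n} {J : Ideal (Formal n)}
    (hd : ∀ k, Θ k - Θ' k ∈ J) (P : Fin n →₀ ℕ) : mpow Θ P - mpow Θ' P ∈ J := by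
  rw [← Ideal.Quotient.eq]
  simp only [mpow, Finsupp.prod, map_prod, map_pow]
  exact Finset.prod_congr rfl fun l _ => by rw [Ideal.Quotient.eq.mpr (hd l)]

theorem subst_sub_subst_mem_of_mpow {n : ℕ} {Θ Θ' : FormalMap n} {V : UpperSet (Fin n →₀ ℕ)}
    (hΘ : VanishesAtZero Θ) (hΘ' : VanishesAtZero Θ') {f : Formal n}
    (h : ∀ P, MvPowerSeries.coeff P f ≠ 0 → mpow Θ P - mpow Θ' P ∈ suppIdeal V) :
    MvPowerSeries.subst Θ f - MvPowerSeries.subst Θ' f ∈ suppIdeal V := by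
  intro Q hQ
  rw [map_sub, sub_eq_zero, coeff_subst_eq_finsum hΘ, coeff_subst_eq_finsum hΘ']
  refine finsum_congr fun P => ?_
  by_cases hP : MvPowerSeries.coeff P f = 0
  · rw [hP, zero_mul, zero_mul]
  · rw [← sub_eq_zero, ← mul_sub, ← map_sub, h P hP Q hQ, mul_zero]

/-- Substitution is compatible with congruence modulo an ideal of monomial type. -/
theorem subst_sub_subst_mem {n : ℕ} {Θ Θ' : FormalMap n} {U : UpperSet (Fin n →₀ ℕ)}
    (hΘ : VanishesAtZero Θ) (hΘ' : VanishesAtZero Θ') (hd : ∀ k, Θ k - Θ' k ∈ suppIdeal U)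
    (f : Formal n) :
    MvPowerSeries.subst Θ f - MvPowerSeries.subst Θ' f ∈ suppIdeal U :=
  subst_sub_subst_mem_of_mpow hΘ hΘ' fun P _ => mpow_sub_mpow_mem hd P

/-- A series of order at least two gains one order in every congruence: if `Θ ≡ Θ'` modulo the
monomials of `U`, then `f(Θ) ≡ f(Θ')` modulo the products of these with nontrivial monomials. -/
theorem subst_sub_subst_mem_of_order {n : ℕ} {Θ Θ' : FormalMap n}
    {U V : UpperSet (Fin n →₀ ℕ)} (hΘ : VanishesAtZero Θ) (hΘ' : VanishesAtZero Θ')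
    (hd : ∀ k, Θ k - Θ' k ∈ suppIdeal U) {f : Formal n} (hf : f ∈ suppIdeal (degGE n 2))
    (hUV : ∀ P ∈ U, ∀ Q ∈ degGE n 1, P + Q ∈ V) :
    MvPowerSeries.subst Θ f - MvPowerSeries.subst Θ' f ∈ suppIdeal V := by
  refine subst_sub_subst_mem_of_mpow hΘ hΘ' fun P hP => ?_
  have hP2 : 2 ≤ P.degree := by
    by_contra hlt
    exact hP (hf P hlt)
  obtain ⟨l, P', rfl⟩ := exists_eq_single_add (P := P) (by rintro rfl; simp at hP2)
  rw [map_add, Finsupp.degree_single] at hP2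
  have hsplit : mpow Θ (Finsupp.single l 1 + P') - mpow Θ' (Finsupp.single l 1 + P') =
      (mpow Θ P' - mpow Θ' P') * Θ l + (Θ l - Θ' l) * mpow Θ' P' := by
    rw [mpow_add, mpow_add, mpow_single, mpow_single]; ring
  rw [hsplit]
  refine add_mem (mul_mem_suppIdeal (mpow_sub_mpow_mem hd P')
    (mem_suppIdeal_degGE_one.mpr (hΘ l)) hUV) (mul_mem_suppIdeal (hd l)
    (suppIdeal_mono (fun Q hQ => ?_) (mpow_mem_degGE hΘ' P')) hUV)
  rw [mem_degGE] at *; omega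

/-! ### Composition of formal maps -/

theorem vanishesAtZero_idMap (n : ℕ) : VanishesAtZero (idMap n) := fun k => by simp [idMap]

theorem VanishesAtZero.comp {n : ℕ} {g h : FormalMap n} (hg : VanishesAtZero g)
    (hh : VanishesAtZero h) : VanishesAtZero (comp g h) := fun k =>
  MvPowerSeries.constantCoeff_subst_eq_zero hh.hasSubst hh (hg k)

theorem VanishesAtZero.conjMap {n : ℕ} {g : FormalMap n} (hg : VanishesAtZero g) :
    VanishesAtZero (conjMap g) := fun k => by
  simp [TotallyReal.conjMap, hg k]

theorem vanishesAtZero_linearMap {n : ℕ} (A : Matrix (Fin n) (Fin n) ℂ) :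
    VanishesAtZero (linearMap A) := fun k => by
  simp [linearMap]

theorem comp_assoc {n : ℕ} (f : FormalMap n) {g h : FormalMap n} (hg : VanishesAtZero g)
    (hh : VanishesAtZero h) : comp (comp f g) h = comp f (comp g h) :=
  funext fun k => MvPowerSeries.subst_comp_subst_apply hg.hasSubst hh.hasSubst (f k)

theorem comp_idMap {n : ℕ} (g : FormalMap n) : comp g (idMap n) = g :=
  funext fun k => congrFun (MvPowerSeries.subst_self (R := ℂ)) (g k)

theorem idMap_comp {n : ℕ} {g : FormalMap n} (hg : VanishesAtZero g) : comp (idMap n) g = g :=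
  funext fun k => MvPowerSeries.subst_X hg.hasSubst k

theorem conjMap_comp {n : ℕ} (g : FormalMap n) {h : FormalMap n} (hh : VanishesAtZero h) :
    conjMap (comp g h) = comp (conjMap g) (conjMap h) :=
  funext fun k => MvPowerSeries.map_subst hh.hasSubst (g k)

theorem conjMap_conjMap {n : ℕ} (g : FormalMap n) : conjMap (conjMap g) = g := by
  funext k; ext Q; simp [conjMap]

theorem conjMap_idMap (n : ℕ) : conjMap (idMap n) = idMap n := by
  funext k; simp [conjMap, idMap]

theorem linearPart_idMap (n : ℕ) : linearPart (idMap n) = 1 := by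
  classical
  ext k l
  simp [linearPart, idMap, MvPowerSeries.coeff_X, Matrix.one_apply, Finsupp.single_left_inj,
    eq_comm]

theorem coeff_single_linearMap {n : ℕ} (A : Matrix (Fin n) (Fin n) ℂ) (k l : Fin n) :
    MvPowerSeries.coeff (Finsupp.single l 1) (linearMap A k) = A k l := by
  classical
  simp [linearMap, MvPowerSeries.coeff_X, Finsupp.single_left_inj]

theorem coeff_linearMap_of_degree_ne_one {n : ℕ} (A : Matrix (Fin n) (Fin n) ℂ) (k : Fin n)
    {Q : Fin n →₀ ℕ} (hQ : Q.degree ≠ 1) : MvPowerSeries.coeff Q (linearMap A k) = 0 := by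
  classical
  simp only [linearMap, map_sum, map_smul]
  refine Finset.sum_eq_zero fun l _ => ?_
  rw [MvPowerSeries.coeff_X, if_neg, smul_zero]
  rintro rfl
  simp at hQ

/-- A map and its linear part differ by terms of order at least two. -/
theorem sub_linearMap_mem {n : ℕ} {g : FormalMap n} (hg : VanishesAtZero g)
    {A : Matrix (Fin n) (Fin n) ℂ} (hA : linearPart g = A) (k : Fin n) :
    g k - linearMap A k ∈ suppIdeal (degGE n 2) := by
  intro Q hQ
  rw [mem_degGE, not_le] at hQ
  rw [map_sub, sub_eq_zero]
  by_cases h0 : Q = 0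
  · subst h0
    exact (hg k).trans (vanishesAtZero_linearMap A k).symm
  · obtain ⟨l, P, rfl⟩ := exists_eq_single_add h0
    rw [map_add, Finsupp.degree_single] at hQ
    have : P = 0 := (Finsupp.degree_eq_zero_iff P).mp (by omega)
    rw [this, add_zero, coeff_single_linearMap, ← hA]
    rfl

theorem subst_linearMap {n : ℕ} (A : Matrix (Fin n) (Fin n) ℂ) {g : FormalMap n}
    (hg : VanishesAtZero g) (k : Fin n) :
    MvPowerSeries.subst g (linearMap A k) = ∑ l, A k l • g l := by
  rw [← MvPowerSeries.coe_substAlgHom hg.hasSubst]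
  simp only [linearMap, map_sum, map_smul]
  refine Finset.sum_congr rfl fun l _ => ?_
  rw [MvPowerSeries.substAlgHom_X]

theorem subst_mem_degGE {n d : ℕ} {g : FormalMap n} (hg : VanishesAtZero g) {f : Formal n}
    (hf : f ∈ suppIdeal (degGE n d)) :
    MvPowerSeries.subst g f ∈ suppIdeal (degGE n d) := by
  intro Q hQ
  rw [coeff_subst_eq_finsum hg]
  refine finsum_eq_zero_of_forall_eq_zero fun P => ?_
  by_cases hP : P ∈ degGE n d
  · have hPQ : Q ∉ degGE n P.degree := fun h =>
      hQ (mem_degGE.mpr (le_trans (mem_degGE.mp hP) (mem_degGE.mp h)))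
    rw [mpow_mem_degGE hg P Q hPQ, mul_zero]
  · rw [hf P hP, zero_mul]

theorem linearPart_comp {n : ℕ} {g h : FormalMap n} (hg : VanishesAtZero g)
    (hh : VanishesAtZero h) : linearPart (comp g h) = linearPart g * linearPart h := by
  ext k l
  have h1 := subst_mem_degGE hh (sub_linearMap_mem hg rfl k) (Finsupp.single l 1) (by simp)
  rw [MvPowerSeries.subst_sub hh.hasSubst, map_sub, sub_eq_zero, subst_linearMap _ hh] at h1
  rw [Matrix.mul_apply]
  refine h1.trans ?_
  simp only [map_sum, map_smul, smul_eq_mul]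
  rfl

theorem linearPart_conjMap {n : ℕ} (g : FormalMap n) :
    linearPart (conjMap g) = (linearPart g).map (starRingEnd ℂ) := by
  ext k l; simp [linearPart, conjMap]

theorem linearMap_one (n : ℕ) : linearMap (1 : Matrix (Fin n) (Fin n) ℂ) = idMap n := by
  funext k
  simp [linearMap, idMap, Matrix.one_apply]

theorem comp_linearMap {n : ℕ} (A B : Matrix (Fin n) (Fin n) ℂ) :
    comp (linearMap A) (linearMap B) = linearMap (A * B) := by
  funext k
  refine (subst_linearMap A (vanishesAtZero_linearMap B) k).trans ?_
  simp only [linearMap, Finset.smul_sum, Matrix.mul_apply, Finset.sum_smul, smul_smul]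
  exact Finset.sum_comm

theorem linearMap_diagonal {n : ℕ} (d : Fin n → ℂ) (k : Fin n) :
    linearMap (Matrix.diagonal d) k = d k • (MvPowerSeries.X k : Formal n) := by
  rw [linearMap, Finset.sum_eq_single k]
  · simp
  · intro l _ hl; rw [Matrix.diagonal_apply_ne' _ hl, zero_smul]
  · simp

/-- Composition with a diagonal linear map multiplies the coefficient of `x^Q` by `d^Q`. -/
theorem coeff_subst_diagonal {n : ℕ} (d : Fin n → ℂ) (f : Formal n) (Q : Fin n →₀ ℕ) :
    MvPowerSeries.coeff Q (MvPowerSeries.subst (linearMap (Matrix.diagonal d)) f) =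
      powQ d Q * MvPowerSeries.coeff Q f := by
  have h : linearMap (Matrix.diagonal d) = d • (MvPowerSeries.X : Fin n → Formal n) :=
    funext fun k => linearMap_diagonal d k
  rw [h, ← MvPowerSeries.rescale_eq_subst, MvPowerSeries.coeff_rescale]
  congr 1
  exact Finsupp.prod_fintype _ _ fun _ => pow_zero _

theorem subst_diagonal_mem {n : ℕ} {U : UpperSet (Fin n →₀ ℕ)} (d : Fin n → ℂ) {f : Formal n}
    (hf : f ∈ suppIdeal U) :
    MvPowerSeries.subst (linearMap (Matrix.diagonal d)) f ∈ suppIdeal U := fun Q hQ => by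
  rw [coeff_subst_diagonal, hf Q hQ, mul_zero]

/-! ### Formal inverses -/

theorem IsTangentToId.vanishesAtZero {n : ℕ} {g : FormalMap n} (h : IsTangentToId g) :
    VanishesAtZero g := h.1

theorem IsTangentToId.sub_X_mem {n : ℕ} {g : FormalMap n} (h : IsTangentToId g) (k : Fin n) :
    g k - MvPowerSeries.X k ∈ suppIdeal (degGE n 2) := by
  have := sub_linearMap_mem h.1 h.2 k
  rwa [linearMap_one] at this

theorem isTangentToId_of_sub_X_mem {n : ℕ} {g : FormalMap n}
    (h : ∀ k, g k - MvPowerSeries.X k ∈ suppIdeal (degGE n 2)) : IsTangentToId g := by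
  refine ⟨fun k => ?_, ?_⟩
  · have := h k 0 (by simp)
    rw [map_sub, sub_eq_zero] at this
    exact this.trans (vanishesAtZero_idMap n k)
  · rw [← linearPart_idMap]
    ext k l
    have := h k (Finsupp.single l 1) (by simp)
    rwa [map_sub, sub_eq_zero] at this

/-- The iterates of `Θ ↦ x - (Ψ - x)(Θ)`, whose limit is the inverse of `Ψ`. -/
noncomputable def inverseIterate {n : ℕ} (Ψ : FormalMap n) : ℕ → FormalMap n
  | 0 => idMap n
  | d + 1 => fun k => MvPowerSeries.X k -
      MvPowerSeries.subst (inverseIterate Ψ d) (Ψ k - MvPowerSeries.X k)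

theorem inverseIterate_vanishes {n : ℕ} {Ψ : FormalMap n} (hΨ : IsTangentToId Ψ) (d : ℕ) :
    VanishesAtZero (inverseIterate Ψ d) := by
  induction d with
  | zero => exact vanishesAtZero_idMap n
  | succ d ih =>
    intro k
    have h1 : MvPowerSeries.constantCoeff (Ψ k - MvPowerSeries.X k) = 0 := by
      simp [hΨ.1 k]
    simp [inverseIterate, MvPowerSeries.constantCoeff_subst_eq_zero ih.hasSubst ih h1]

theorem inverseIterate_succ_sub {n : ℕ} {Ψ : FormalMap n} (hΨ : IsTangentToId Ψ) (d : ℕ)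
    (k : Fin n) :
    inverseIterate Ψ (d + 1) k - inverseIterate Ψ d k ∈ suppIdeal (degGE n (d + 1)) := by
  induction d generalizing k with
  | zero =>
    rw [mem_suppIdeal_degGE_one, map_sub, inverseIterate_vanishes hΨ 1 k,
      inverseIterate_vanishes hΨ 0 k, sub_zero]
  | succ d ih =>
    have h := subst_sub_subst_mem_of_order (inverseIterate_vanishes hΨ (d + 1))
      (inverseIterate_vanishes hΨ d) ih (hΨ.sub_X_mem k) (V := degGE n (d + 1 + 1))
      fun P hP Q hQ => by
        rw [mem_degGE] at *; rw [map_add]; omega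
    have h' := neg_mem h
    rw [neg_sub] at h'
    convert h' using 1
    rw [inverseIterate, inverseIterate]
    ring

theorem inverseIterate_sub_mem {n : ℕ} {Ψ : FormalMap n} (hΨ : IsTangentToId Ψ) {d e : ℕ}
    (hde : d ≤ e) (k : Fin n) :
    inverseIterate Ψ e k - inverseIterate Ψ d k ∈ suppIdeal (degGE n (d + 1)) := by
  induction e, hde using Nat.le_induction with
  | base => simp
  | succ e hde ih =>
    have h := suppIdeal_mono (V := degGE n (d + 1)) (fun Q hQ => by
      rw [mem_degGE] at *; omega) (inverseIterate_succ_sub hΨ e k)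
    have := add_mem h ih
    rwa [sub_add_sub_cancel] at this

/-- A formal map tangent to the identity has a right inverse for the composition. -/
theorem exists_right_inverse {n : ℕ} {Ψ : FormalMap n} (hΨ : IsTangentToId Ψ) :
    ∃ Φ : FormalMap n, IsTangentToId Φ ∧ comp Ψ Φ = idMap n := by
  let Φ : FormalMap n := fun k Q => MvPowerSeries.coeff Q (inverseIterate Ψ Q.degree k)
  have hΦ : ∀ d k, Φ k - inverseIterate Ψ d k ∈ suppIdeal (degGE n (d + 1)) := by
    intro d k Q hQ
    rw [mem_degGE, not_le, Nat.lt_succ_iff] at hQ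
    have h := inverseIterate_sub_mem hΨ hQ k Q (by simp)
    rw [map_sub, sub_eq_zero] at h ⊢
    exact h.symm
  have hΦ0 : VanishesAtZero Φ := fun k => inverseIterate_vanishes hΨ 0 k
  have hfix : ∀ k, Φ k = MvPowerSeries.X k -
      MvPowerSeries.subst Φ (Ψ k - MvPowerSeries.X k) := by
    intro k
    rw [← sub_eq_zero]
    ext Q
    have h1 := hΦ (Q.degree + 1) k Q (by simp)
    have h2 := subst_sub_subst_mem hΦ0 (inverseIterate_vanishes hΨ Q.degree)
      (hΦ Q.degree) (Ψ k - MvPowerSeries.X k) Q (by simp)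
    rw [map_sub, sub_eq_zero] at h1 h2
    rw [map_sub, h1, inverseIterate, map_sub, map_sub, h2]
    simp
  refine ⟨Φ, isTangentToId_of_sub_X_mem fun k => ?_, funext fun k => ?_⟩
  · rw [hfix k, sub_sub_cancel_left]
    exact neg_mem (subst_mem_degGE hΦ0 (hΨ.sub_X_mem k))
  · have h := hfix k
    rw [MvPowerSeries.subst_sub hΦ0.hasSubst, MvPowerSeries.subst_X hΦ0.hasSubst] at h
    have : MvPowerSeries.subst Φ (Ψ k) = MvPowerSeries.X k := by
      linear_combination h
    exact this

/-- A formal map tangent to the identity has an inverse for the composition. -/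
theorem exists_isInverse {n : ℕ} {Ψ : FormalMap n} (hΨ : IsTangentToId Ψ) :
    ∃ Φ : FormalMap n, IsTangentToId Φ ∧ IsInverse Φ Ψ := by
  obtain ⟨Φ, hΦ, h1⟩ := exists_right_inverse hΨ
  obtain ⟨Ψ', hΨ', h2⟩ := exists_right_inverse hΦ
  have : Ψ = Ψ' := by
    rw [← comp_idMap Ψ, ← h2, ← comp_assoc _ hΦ.1 hΨ'.1, h1, idMap_comp hΨ'.1]
  exact ⟨Φ, hΦ, this ▸ h2, h1⟩

/-! ### Majorant series -/

/-- The value at `(r, …, r)` of a series with coefficients in `[0, ∞]`. -/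
noncomputable def normE {n : ℕ} (r : ℝ≥0∞) (f : MvPowerSeries (Fin n) ℝ≥0∞) : ℝ≥0∞ :=
  ∑' Q, MvPowerSeries.coeff Q f * r ^ Q.degree

/-- The series of the absolute values of the coefficients. -/
noncomputable def absSeries {n : ℕ} (f : Formal n) : MvPowerSeries (Fin n) ℝ≥0∞ :=
  fun Q => ‖MvPowerSeries.coeff Q f‖ₑ

theorem coeff_absSeries {n : ℕ} (f : Formal n) (Q : Fin n →₀ ℕ) :
    MvPowerSeries.coeff Q (absSeries f) = ‖MvPowerSeries.coeff Q f‖ₑ := rfl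

theorem normE_mono {n : ℕ} {r s : ℝ≥0∞} {f g : MvPowerSeries (Fin n) ℝ≥0∞} (hrs : r ≤ s)
    (h : ∀ Q, MvPowerSeries.coeff Q f ≤ MvPowerSeries.coeff Q g) : normE r f ≤ normE s g :=
  ENNReal.tsum_le_tsum fun Q => by gcongr; exact h Q

theorem normE_add {n : ℕ} (r : ℝ≥0∞) (f g : MvPowerSeries (Fin n) ℝ≥0∞) :
    normE r (f + g) = normE r f + normE r g := by
  simp only [normE, map_add, add_mul]
  exact ENNReal.tsum_add

theorem normE_sum {n : ℕ} {ι : Type*} (s : Finset ι) (r : ℝ≥0∞)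
    (f : ι → MvPowerSeries (Fin n) ℝ≥0∞) :
    normE r (∑ i ∈ s, f i) = ∑ i ∈ s, normE r (f i) := by
  classical
  induction s using Finset.induction_on with
  | empty => simp [normE]
  | insert i s hi ih => rw [Finset.sum_insert hi, Finset.sum_insert hi, normE_add, ih]

theorem normE_mul {n : ℕ} (r : ℝ≥0∞) (f g : MvPowerSeries (Fin n) ℝ≥0∞) :
    normE r (f * g) = normE r f * normE r g := by
  classical
  have h : normE r f * normE r g = ∑' p : (Fin n →₀ ℕ) × (Fin n →₀ ℕ),
      (MvPowerSeries.coeff p.1 f * r ^ p.1.degree) *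
        (MvPowerSeries.coeff p.2 g * r ^ p.2.degree) := by
    rw [ENNReal.tsum_prod', normE, ← ENNReal.tsum_mul_right]
    exact tsum_congr fun P => ENNReal.tsum_mul_left.symm
  rw [h, ← Finset.HasAntidiagonal.sigmaAntidiagonalEquivProd.tsum_eq, ENNReal.tsum_sigma', normE]
  refine tsum_congr fun Q => ?_
  rw [MvPowerSeries.coeff_mul, tsum_fintype, Finset.univ_eq_attach, Finset.sum_mul,
    ← Finset.sum_attach]
  refine Finset.sum_congr rfl fun p _ => ?_
  have hQ : Q.degree = p.1.1.degree + p.1.2.degree := by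
    rw [← map_add, Finset.HasAntidiagonal.mem_antidiagonal.mp p.2]
  rw [hQ, pow_add]
  exact mul_mul_mul_comm _ _ _ _

theorem normE_one {n : ℕ} (r : ℝ≥0∞) : normE r (1 : MvPowerSeries (Fin n) ℝ≥0∞) = 1 := by
  classical
  rw [normE, tsum_eq_single 0 fun Q hQ => by rw [MvPowerSeries.coeff_one, if_neg hQ, zero_mul]]
  simp

theorem normE_pow {n : ℕ} (r : ℝ≥0∞) (f : MvPowerSeries (Fin n) ℝ≥0∞) (d : ℕ) :
    normE r (f ^ d) = normE r f ^ d := by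
  induction d with
  | zero => rw [pow_zero, pow_zero, normE_one]
  | succ d ih => rw [pow_succ, normE_mul, ih, pow_succ]

theorem summable_iff_normE_ne_top {n : ℕ} (f : Formal n) (r : ℝ≥0) :
    (Summable fun Q : Fin n →₀ ℕ => ‖MvPowerSeries.coeff Q f‖ * (r : ℝ) ^ Q.degree) ↔
      normE r (absSeries f) ≠ ∞ := by
  have h : normE r (absSeries f) =
      ∑' Q : Fin n →₀ ℕ, ((‖MvPowerSeries.coeff Q f‖₊ * r ^ Q.degree : ℝ≥0) : ℝ≥0∞) :=
    tsum_congr fun Q => by rw [coeff_absSeries]; push_cast; rfl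
  rw [h, ENNReal.tsum_coe_ne_top_iff_summable, ← NNReal.summable_coe]
  push_cast
  rfl

theorem isConvergent_iff_normE {n : ℕ} (f : Formal n) :
    IsConvergent f ↔ ∃ r : ℝ≥0, 0 < r ∧ normE r (absSeries f) ≠ ∞ := by
  constructor
  · rintro ⟨r, hr, h⟩
    exact ⟨⟨r, hr.le⟩, hr, (summable_iff_normE_ne_top f ⟨r, hr.le⟩).mp h⟩
  · rintro ⟨r, hr, h⟩
    exact ⟨r, hr, (summable_iff_normE_ne_top f r).mpr h⟩

theorem IsConvergent.sub {n : ℕ} {f g : Formal n} (hf : IsConvergent f) (hg : IsConvergent g) :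
    IsConvergent (f - g) := (Holo n).sub_mem hf hg

/-- Finitely many convergent series converge on a common polydisc. -/
theorem exists_common_radius {n : ℕ} {ι : Type*} [Finite ι] {f : ι → Formal n}
    (hf : ∀ i, IsConvergent (f i)) :
    ∃ r : ℝ≥0, 0 < r ∧ ∀ i, normE r (absSeries (f i)) ≠ ∞ := by
  choose r hr h using fun i => (isConvergent_iff_normE (f i)).mp (hf i)
  have := Fintype.ofFinite ι
  have hex : ∃ s : ℝ≥0, 0 < s ∧ ∀ i, s ≤ r i := by
    rcases isEmpty_or_nonempty ι with hι | hι
    · exact ⟨1, one_pos, fun i => hι.elim i⟩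
    · obtain ⟨i, hi⟩ := Finite.exists_min r
      exact ⟨r i, hr i, hi⟩
  obtain ⟨s, hs, hsr⟩ := hex
  exact ⟨s, hs, fun i => ne_top_of_le_ne_top (h i)
    (normE_mono (by exact_mod_cast hsr i) fun _ => le_rfl)⟩

/-- A majorant series without constant term is small on small polydiscs. -/
theorem exists_normE_le {n : ℕ} {A : MvPowerSeries (Fin n) ℝ≥0∞}
    (hA0 : MvPowerSeries.coeff 0 A = 0) {r s : ℝ≥0} (hr : 0 < r) (hs : 0 < s)
    (hA : normE r A ≠ ∞) : ∃ t : ℝ≥0, 0 < t ∧ normE t A ≤ s := by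
  obtain ⟨M, hM⟩ : ∃ M : ℝ≥0, (M : ℝ≥0∞) = normE r A := ⟨_, ENNReal.coe_toNNReal hA⟩
  set c : ℝ≥0 := min 1 (s / (M + 1)) with hc
  have hc0 : 0 < c := lt_min one_pos (by positivity)
  refine ⟨c * r, by positivity, ?_⟩
  have hle : normE (c * r : ℝ≥0) A ≤ c * normE r A := by
    rw [normE, normE, ← ENNReal.tsum_mul_left]
    refine ENNReal.tsum_le_tsum fun Q => ?_
    by_cases hQ : Q = 0
    · simp [hQ, hA0]
    · have hd : Q.degree ≠ 0 := fun h => hQ ((Finsupp.degree_eq_zero_iff Q).mp h)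
      have hcd : (c : ℝ≥0∞) ^ Q.degree ≤ c :=
        pow_le_of_le_one zero_le (by exact_mod_cast min_le_left _ _) hd
      rw [ENNReal.coe_mul, mul_pow, mul_left_comm]
      gcongr
  refine hle.trans ?_
  rw [← hM]
  have : c * M ≤ s := by
    calc c * M ≤ s / (M + 1) * (M + 1) := by
          gcongr
          · exact min_le_right _ _
          · exact le_self_add
      _ = s := div_mul_cancel₀ _ (by positivity)
  exact_mod_cast this

theorem enorm_coeff_mpow_le {n : ℕ} {Θ : FormalMap n} {A : MvPowerSeries (Fin n) ℝ≥0∞}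
    (hA : ∀ k Q, ‖MvPowerSeries.coeff Q (Θ k)‖ₑ ≤ MvPowerSeries.coeff Q A)
    (P Q : Fin n →₀ ℕ) :
    ‖MvPowerSeries.coeff Q (mpow Θ P)‖ₑ ≤ MvPowerSeries.coeff Q (A ^ P.degree) := by
  classical
  induction hd : P.degree generalizing P Q with
  | zero =>
    rw [(Finsupp.degree_eq_zero_iff P).mp hd, mpow_zero, pow_zero, MvPowerSeries.coeff_one,
      MvPowerSeries.coeff_one]
    split_ifs <;> simp
  | succ d ih =>
    obtain ⟨l, P', rfl⟩ := exists_eq_single_add (P := P) (by rintro rfl; simp at hd)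
    rw [map_add, Finsupp.degree_single] at hd
    rw [mpow_add, mpow_single, pow_succ', MvPowerSeries.coeff_mul, MvPowerSeries.coeff_mul]
    refine (enorm_sum_le _ _).trans (Finset.sum_le_sum fun p _ => ?_)
    rw [enorm_mul]
    exact mul_le_mul' (hA l p.1) (ih P' p.2 (by omega))

theorem enorm_coeff_subst_le {n : ℕ} {Θ : FormalMap n} (hΘ : VanishesAtZero Θ)
    {A : MvPowerSeries (Fin n) ℝ≥0∞}
    (hA : ∀ k Q, ‖MvPowerSeries.coeff Q (Θ k)‖ₑ ≤ MvPowerSeries.coeff Q A) (f : Formal n)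
    (Q : Fin n →₀ ℕ) :
    ‖MvPowerSeries.coeff Q (MvPowerSeries.subst Θ f)‖ₑ ≤
      ∑' P : Fin n →₀ ℕ, ‖MvPowerSeries.coeff P f‖ₑ * MvPowerSeries.coeff Q (A ^ P.degree) := by
  have hfin := MvPowerSeries.coeff_subst_finite hΘ.hasSubst f Q
  rw [coeff_subst_eq_finsum hΘ, finsum_eq_sum (fun P => MvPowerSeries.coeff P f *
    MvPowerSeries.coeff Q (mpow Θ P)) hfin]
  refine (enorm_sum_le _ _).trans (le_trans (Finset.sum_le_sum fun P _ => ?_)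
    (ENNReal.sum_le_tsum _))
  rw [enorm_mul]
  gcongr
  exact enorm_coeff_mpow_le hA P Q

/-- The composition of convergent series is convergent. -/
theorem IsConvergent.subst {n : ℕ} {f : Formal n} {Θ : FormalMap n} (hf : IsConvergent f)
    (hΘ : VanishesAtZero Θ) (hc : ∀ k, IsConvergent (Θ k)) :
    IsConvergent (MvPowerSeries.subst Θ f) := by
  obtain ⟨s, hs, hfs⟩ := (isConvergent_iff_normE f).mp hf
  obtain ⟨r, hr, hΘr⟩ := exists_common_radius hc
  set A : MvPowerSeries (Fin n) ℝ≥0∞ := ∑ k, absSeries (Θ k) with hA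
  have hle : ∀ k Q, ‖MvPowerSeries.coeff Q (Θ k)‖ₑ ≤ MvPowerSeries.coeff Q A := by
    intro k Q
    rw [hA, map_sum]
    exact Finset.single_le_sum (f := fun k => MvPowerSeries.coeff Q (absSeries (Θ k)))
      (fun _ _ => zero_le) (Finset.mem_univ k)
  have hA0 : MvPowerSeries.coeff 0 A = 0 := by
    rw [hA, map_sum]
    refine Finset.sum_eq_zero fun k _ => ?_
    rw [coeff_absSeries, MvPowerSeries.coeff_zero_eq_constantCoeff_apply, hΘ k, enorm_zero]
  have hAr : normE r A ≠ ∞ := by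
    rw [hA, normE_sum]
    exact (ENNReal.sum_lt_top.mpr fun k _ => (hΘr k).lt_top).ne
  obtain ⟨t, ht, hAt⟩ := exists_normE_le hA0 hr hs hAr
  refine (isConvergent_iff_normE _).mpr ⟨t, ht, ne_top_of_le_ne_top hfs ?_⟩
  calc normE t (absSeries (MvPowerSeries.subst Θ f))
      ≤ ∑' Q : Fin n →₀ ℕ, ∑' P : Fin n →₀ ℕ, ‖MvPowerSeries.coeff P f‖ₑ *
          MvPowerSeries.coeff Q (A ^ P.degree) * (t : ℝ≥0∞) ^ Q.degree := by
        refine ENNReal.tsum_le_tsum fun Q => ?_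
        rw [ENNReal.tsum_mul_right]
        gcongr
        exact enorm_coeff_subst_le hΘ hle f Q
    _ = ∑' P : Fin n →₀ ℕ, ‖MvPowerSeries.coeff P f‖ₑ * normE t A ^ P.degree := by
        rw [ENNReal.tsum_comm]
        refine tsum_congr fun P => ?_
        rw [← normE_pow, normE, ← ENNReal.tsum_mul_left]
        simp only [mul_assoc]
    _ ≤ normE s (absSeries f) := ENNReal.tsum_le_tsum fun P => by
        rw [coeff_absSeries]; gcongr

/-- The series `∑_{d ≥ 2} (b A)^d`. -/
noncomputable def geomTail {n : ℕ} (b : ℝ≥0∞) (A : MvPowerSeries (Fin n) ℝ≥0∞) :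
    MvPowerSeries (Fin n) ℝ≥0∞ :=
  fun Q => ∑' d : ℕ, b ^ (d + 2) * MvPowerSeries.coeff Q (A ^ (d + 2))

theorem coeff_geomTail {n : ℕ} (b : ℝ≥0∞) (A : MvPowerSeries (Fin n) ℝ≥0∞)
    (Q : Fin n →₀ ℕ) :
    MvPowerSeries.coeff Q (geomTail b A) =
      ∑' d : ℕ, b ^ (d + 2) * MvPowerSeries.coeff Q (A ^ (d + 2)) := rfl

theorem coeff_geomTail_eq_sum {n : ℕ} (b : ℝ≥0∞) (A : MvPowerSeries (Fin n) ℝ≥0∞)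
    (Q : Fin n →₀ ℕ) :
    MvPowerSeries.coeff Q (geomTail b A) =
      ∑ p ∈ Finset.HasAntidiagonal.antidiagonal Q, b * MvPowerSeries.coeff p.1 A *
        (b * MvPowerSeries.coeff p.2 A + MvPowerSeries.coeff p.2 (geomTail b A)) := by
  classical
  rw [coeff_geomTail, tsum_eq_zero_add' ENNReal.summable]
  simp only [mul_add, Finset.sum_add_distrib]
  congr 1
  · rw [zero_add, pow_two A, MvPowerSeries.coeff_mul, Finset.mul_sum]
    exact Finset.sum_congr rfl fun p _ => by ring
  · simp only [coeff_geomTail, ← ENNReal.tsum_mul_left]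
    rw [← Summable.tsum_finsetSum fun _ _ => ENNReal.summable]
    refine tsum_congr fun d => ?_
    rw [show d + 1 + 2 = (d + 2) + 1 by ring, pow_succ' A, MvPowerSeries.coeff_mul,
      Finset.mul_sum]
    exact Finset.sum_congr rfl fun p _ => by ring

theorem geomTail_mono {n : ℕ} {b c : ℝ≥0∞} (hbc : b ≤ c) (A : MvPowerSeries (Fin n) ℝ≥0∞)
    (Q : Fin n →₀ ℕ) :
    MvPowerSeries.coeff Q (geomTail b A) ≤ MvPowerSeries.coeff Q (geomTail c A) :=
  ENNReal.tsum_le_tsum fun d => by gcongr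

/-- Cauchy estimates: a convergent series of order at least two is majorized by a geometric one,
uniformly in the substituted series. -/
theorem exists_subst_le_geomTail {n : ℕ} {f : Formal n} (hf : IsConvergent f)
    (hf2 : f ∈ suppIdeal (degGE n 2)) :
    ∃ b : ℝ≥0, ∀ (A : MvPowerSeries (Fin n) ℝ≥0∞) (Q : Fin n →₀ ℕ),
      ∑' P : Fin n →₀ ℕ, ‖MvPowerSeries.coeff P f‖ₑ * MvPowerSeries.coeff Q (A ^ P.degree) ≤
        MvPowerSeries.coeff Q (geomTail b A) := by
  obtain ⟨r, hr, hfr⟩ := (isConvergent_iff_normE f).mp hf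
  obtain ⟨M, hM⟩ : ∃ M : ℝ≥0, (M : ℝ≥0∞) = normE r (absSeries f) :=
    ⟨_, ENNReal.coe_toNNReal hfr⟩
  set b : ℝ≥0 := max M 1 / r with hb
  refine ⟨b, fun A Q => ?_⟩
  rw [← ENNReal.tsum_fiberwise _ (Finsupp.degree : (Fin n →₀ ℕ) → ℕ)]
  have hsum : ∀ d : ℕ, (∑' P : (Finsupp.degree : (Fin n →₀ ℕ) → ℕ) ⁻¹' {d},
      ‖MvPowerSeries.coeff P.1 f‖ₑ * MvPowerSeries.coeff Q (A ^ P.1.degree)) =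
      (∑' P : (Finsupp.degree : (Fin n →₀ ℕ) → ℕ) ⁻¹' {d}, ‖MvPowerSeries.coeff P.1 f‖ₑ) *
        MvPowerSeries.coeff Q (A ^ d) := by
    intro d
    rw [← ENNReal.tsum_mul_right]
    exact tsum_congr fun P => by rw [show P.1.degree = d from P.2]
  simp only [hsum]
  have hlow : ∀ d < 2, (∑' P : (Finsupp.degree : (Fin n →₀ ℕ) → ℕ) ⁻¹' {d},
      ‖MvPowerSeries.coeff P.1 f‖ₑ) = 0 := by
    intro d hd
    refine ENNReal.tsum_eq_zero.mpr fun P => ?_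
    rw [hf2 P.1 (by rw [mem_degGE, show P.1.degree = d from P.2]; omega), enorm_zero]
  have hhigh : ∀ d : ℕ, (∑' P : (Finsupp.degree : (Fin n →₀ ℕ) → ℕ) ⁻¹' {d + 2},
      ‖MvPowerSeries.coeff P.1 f‖ₑ) ≤ (b : ℝ≥0∞) ^ (d + 2) := by
    intro d
    have h1 : (∑' P : (Finsupp.degree : (Fin n →₀ ℕ) → ℕ) ⁻¹' {d + 2},
        ‖MvPowerSeries.coeff P.1 f‖ₑ) * (r : ℝ≥0∞) ^ (d + 2) ≤ M := by
      rw [hM, normE, ← ENNReal.tsum_fiberwise _ (Finsupp.degree : (Fin n →₀ ℕ) → ℕ),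
        ← ENNReal.tsum_mul_right]
      refine le_trans (le_of_eq ?_) (ENNReal.le_tsum (d + 2))
      exact tsum_congr fun P => by
        rw [coeff_absSeries, show P.1.degree = d + 2 from P.2]
    have h2 : (M : ℝ≥0∞) ≤ (b : ℝ≥0∞) ^ (d + 2) * (r : ℝ≥0∞) ^ (d + 2) := by
      have : M ≤ b ^ (d + 2) * r ^ (d + 2) := by
        rw [← mul_pow, hb, div_mul_cancel₀ _ hr.ne']
        exact (le_max_left M 1).trans (le_self_pow₀ (le_max_right M 1) (by omega))
      exact_mod_cast this
    exact (ENNReal.mul_le_mul_iff_left (pow_ne_zero _ (by exact_mod_cast hr.ne'))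
      (ENNReal.pow_ne_top ENNReal.coe_ne_top)).mp (h1.trans h2)
  rw [tsum_eq_zero_add' ENNReal.summable, tsum_eq_zero_add' ENNReal.summable, hlow 0 (by norm_num),
    hlow (0 + 1) (by norm_num), zero_mul, zero_mul, zero_add, zero_add, coeff_geomTail]
  exact ENNReal.tsum_le_tsum fun d => mul_le_mul' (hhigh d) le_rfl

/-! ### Trees and the convergence of recursive series -/

/-- `DivisorTree true Q N`: there is a tree with root `Q` in the expansion of the solution of the
linearization equation, and `N` lists the exponents of its inner nodes. A leaf is the exponent of a
variable; the exponent of an inner node is the sum of those of its children.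
`DivisorTree false Q N`: the same for forests of at least two trees, with the sum `Q` of the
exponents of the roots. -/
inductive DivisorTree {n : ℕ} : Bool → (Fin n →₀ ℕ) → Multiset (Fin n →₀ ℕ) → Prop
  | leaf (l : Fin n) : DivisorTree true (Finsupp.single l 1) 0
  | node (Q : Fin n →₀ ℕ) (N : Multiset (Fin n →₀ ℕ)) :
      DivisorTree false Q N → DivisorTree true Q (Q ::ₘ N)
  | join (t : Bool) (Q₁ Q₂ : Fin n →₀ ℕ) (N₁ N₂ : Multiset (Fin n →₀ ℕ)) :
      DivisorTree true Q₁ N₁ → DivisorTree t Q₂ N₂ → DivisorTree false (Q₁ + Q₂) (N₁ + N₂)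

theorem DivisorTree.degree_pos {n : ℕ} {t : Bool} {Q : Fin n →₀ ℕ} {N : Multiset (Fin n →₀ ℕ)}
    (h : DivisorTree t Q N) : 1 ≤ Q.degree := by
  induction h with
  | leaf l => simp
  | node Q N _ ih => exact ih
  | join t Q₁ Q₂ N₁ N₂ _ _ ih₁ ih₂ => rw [map_add]; omega

theorem DivisorTree.two_le_degree {n : ℕ} {Q : Fin n →₀ ℕ} {N : Multiset (Fin n →₀ ℕ)}
    (h : DivisorTree false Q N) : 2 ≤ Q.degree := by
  cases h with
  | join t Q₁ Q₂ N₁ N₂ h₁ h₂ =>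
    have := h₁.degree_pos
    have := h₂.degree_pos
    rw [map_add]; omega

theorem DivisorTree.degree_mem {n : ℕ} {t : Bool} {Q : Fin n →₀ ℕ}
    {N : Multiset (Fin n →₀ ℕ)} (h : DivisorTree t Q N) :
    ∀ P ∈ N, 2 ≤ P.degree ∧ P.degree ≤ Q.degree := by
  induction h with
  | leaf l => simp
  | node Q N h ih =>
    intro P hP
    rcases Multiset.mem_cons.mp hP with rfl | hP
    · exact ⟨h.two_le_degree, le_rfl⟩
    · exact ih P hP
  | join t Q₁ Q₂ N₁ N₂ _ _ ih₁ ih₂ =>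
    intro P hP
    rw [map_add]
    rcases Multiset.mem_add.mp hP with hP | hP
    · have := ih₁ P hP; omega
    · have := ih₂ P hP; omega

theorem DivisorTree.card_le {n : ℕ} {t : Bool} {Q : Fin n →₀ ℕ} {N : Multiset (Fin n →₀ ℕ)}
    (h : DivisorTree t Q N) : Multiset.card N + (if t then 1 else 2) ≤ Q.degree := by
  induction h with
  | leaf l => simp
  | node Q N _ ih => rw [Multiset.card_cons]; exact ih
  | join t Q₁ Q₂ N₁ N₂ _ _ ih₁ ih₂ =>
    rw [map_add, Multiset.card_add]
    cases t <;> simp at * <;> omega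

/-- Brjuno's counting argument. If small divisors (the exponents satisfying `small`) occur only in
degrees above `m`, and comparable ones differ in degree by at least `m`, then a tree has at most
`2|Q|/m - 1` nodes with a small divisor, unless it has none. The induction also needs the better
bound for a tree hanging below a small divisor `Q'`, where one unit is left for `Q'` itself. -/
theorem DivisorTree.count_aux {n m : ℕ} {small : (Fin n →₀ ℕ) → Prop} [DecidablePred small]
    (hdeg : ∀ Q, small Q → m < Q.degree)
    (hgap : ∀ Q Q', small Q → small Q' → Q ≤ Q' → Q ≠ Q' → Q.degree + m ≤ Q'.degree)
    {t : Bool} {Q : Fin n →₀ ℕ} {N : Multiset (Fin n →₀ ℕ)} (h : DivisorTree t Q N) :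
    (N.countP small = 0 ∨ m * (N.countP small + 1) ≤ 2 * Q.degree) ∧
      ∀ Q', small Q' → Q ≤ Q' → (t = true → Q ≠ Q') →
        m * (N.countP small + 2) ≤ 2 * Q'.degree := by
  induction h with
  | leaf l =>
    refine ⟨Or.inl (by simp), fun Q' hQ' _ _ => ?_⟩
    have := hdeg Q' hQ'
    simp only [Multiset.countP_zero]
    omega
  | node Q N _ ih =>
    by_cases hQ : small Q
    · rw [Multiset.countP_cons_of_pos _ hQ]
      have h1 := ih.2 Q hQ le_rfl (by simp)
      refine ⟨Or.inr h1, fun Q' hQ' hle hne => ?_⟩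
      have h2 := hgap Q Q' hQ hQ' hle (hne rfl)
      calc m * (N.countP small + 1 + 2) = m * (N.countP small + 2) + m := by ring
        _ ≤ 2 * Q'.degree := by omega
    · rw [Multiset.countP_cons_of_neg _ hQ]
      exact ⟨ih.1, fun Q' hQ' hle _ => ih.2 Q' hQ' hle (by simp)⟩
  | join t Q₁ Q₂ N₁ N₂ h₁ h₂ ih₁ ih₂ =>
    have hp₁ := h₁.degree_pos
    have hp₂ := h₂.degree_pos
    rw [Multiset.countP_add, map_add]
    have hlt₁ : ∀ Q', Q₁ + Q₂ ≤ Q' → Q₁ ≤ Q' ∧ Q₁ ≠ Q' := by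
      refine fun Q' hle => ⟨le_self_add.trans hle, ?_⟩
      rintro rfl
      have := Finsupp.degree_mono hle
      rw [map_add] at this; omega
    have hlt₂ : ∀ Q', Q₁ + Q₂ ≤ Q' → Q₂ ≤ Q' ∧ Q₂ ≠ Q' := by
      refine fun Q' hle => ⟨le_add_self.trans hle, ?_⟩
      rintro rfl
      have := Finsupp.degree_mono hle
      rw [map_add] at this; omega
    rcases ih₁.1 with z₁ | b₁
    · rw [z₁, zero_add]
      refine ⟨ih₂.1.imp_right fun h => by omega, fun Q' hQ' hle _ => ?_⟩
      exact ih₂.2 Q' hQ' (hlt₂ Q' hle).1 fun _ => (hlt₂ Q' hle).2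
    · rcases ih₂.1 with z₂ | b₂
      · rw [z₂, add_zero]
        refine ⟨Or.inr (by omega), fun Q' hQ' hle _ => ?_⟩
        exact ih₁.2 Q' hQ' (hlt₁ Q' hle).1 fun _ => (hlt₁ Q' hle).2
      · have hsum : m * (N₁.countP small + N₂.countP small + 2) ≤ 2 * (Q₁.degree + Q₂.degree) := by
          calc m * (N₁.countP small + N₂.countP small + 2)
              = m * (N₁.countP small + 1) + m * (N₂.countP small + 1) := by ring
            _ ≤ _ := by omega
        refine ⟨Or.inr (le_trans (Nat.mul_le_mul_left m (by omega)) hsum),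
          fun Q' _ hle _ => hsum.trans ?_⟩
        have := Finsupp.degree_mono hle
        rw [map_add] at this; omega

theorem DivisorTree.mul_countP_le {n m : ℕ} {small : (Fin n →₀ ℕ) → Prop}
    [DecidablePred small] (hdeg : ∀ Q, small Q → m < Q.degree)
    (hgap : ∀ Q Q', small Q → small Q' → Q ≤ Q' → Q ≠ Q' → Q.degree + m ≤ Q'.degree)
    {t : Bool} {Q : Fin n →₀ ℕ} {N : Multiset (Fin n →₀ ℕ)} (h : DivisorTree t Q N) :
    m * N.countP small ≤ 2 * Q.degree := by
  rcases (h.count_aux hdeg hgap).1 with h0 | h1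
  · simp [h0]
  · exact le_trans (Nat.mul_le_mul_left m (Nat.le_succ _)) h1

/-- The largest product of the factors `cost` over the inner nodes of a tree (or forest) with
exponent `Q`. -/
noncomputable def treeSup {n : ℕ} (cost : (Fin n →₀ ℕ) → ℝ≥0∞) (t : Bool) (Q : Fin n →₀ ℕ) :
    ℝ≥0∞ :=
  ⨆ (N : Multiset (Fin n →₀ ℕ)) (_ : DivisorTree t Q N), (N.map cost).prod

theorem le_treeSup {n : ℕ} (cost : (Fin n →₀ ℕ) → ℝ≥0∞) {t : Bool} {Q : Fin n →₀ ℕ}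
    {N : Multiset (Fin n →₀ ℕ)} (h : DivisorTree t Q N) :
    (N.map cost).prod ≤ treeSup cost t Q :=
  le_iSup₂_of_le N h le_rfl

theorem treeSup_mul_le {n : ℕ} (cost : (Fin n →₀ ℕ) → ℝ≥0∞) (t : Bool) (Q₁ Q₂ : Fin n →₀ ℕ) :
    treeSup cost true Q₁ * treeSup cost t Q₂ ≤ treeSup cost false (Q₁ + Q₂) := by
  simp only [treeSup, ENNReal.iSup_mul, ENNReal.mul_iSup]
  refine iSup₂_le fun N₂ h₂ => iSup₂_le fun N₁ h₁ => ?_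
  rw [← Multiset.prod_add, ← Multiset.map_add]
  exact le_treeSup cost (.join t _ _ _ _ h₁ h₂)

theorem cost_mul_treeSup_le {n : ℕ} (cost : (Fin n →₀ ℕ) → ℝ≥0∞) (Q : Fin n →₀ ℕ) :
    cost Q * treeSup cost false Q ≤ treeSup cost true Q := by
  conv_lhs => rw [treeSup]
  simp only [ENNReal.mul_iSup]
  refine iSup₂_le fun N h => ?_
  rw [← Multiset.prod_cons, ← Multiset.map_cons]
  exact le_treeSup cost (.node Q N h)

/-- The iterates of `κ ↦ x₁ + ⋯ + xₙ + β κ²`. -/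
noncomputable def majorantIterate (n : ℕ) (β : ℝ≥0) : ℕ → MvPowerSeries (Fin n) ℝ≥0∞
  | 0 => 0
  | N + 1 => ∑ l, MvPowerSeries.X l +
      MvPowerSeries.C (β : ℝ≥0∞) * (majorantIterate n β N * majorantIterate n β N)

theorem normE_X_le {n : ℕ} (r : ℝ≥0∞) (l : Fin n) :
    normE r (MvPowerSeries.X l : MvPowerSeries (Fin n) ℝ≥0∞) ≤ r := by
  classical
  rw [normE, tsum_eq_single (Finsupp.single l 1) fun Q hQ => by
    rw [MvPowerSeries.coeff_X, if_neg hQ, zero_mul]]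
  simp [MvPowerSeries.coeff_X]

theorem normE_C {n : ℕ} (r c : ℝ≥0∞) :
    normE r (MvPowerSeries.C c : MvPowerSeries (Fin n) ℝ≥0∞) = c := by
  classical
  rw [normE, tsum_eq_single 0 fun Q hQ => by
    rw [MvPowerSeries.coeff_C, if_neg hQ, zero_mul]]
  simp

theorem normE_majorantIterate_le {n : ℕ} {β r : ℝ≥0} (h : β * (4 * (n * r)) ≤ 1) (N : ℕ) :
    normE r (majorantIterate n β N) ≤ (2 * (n * r) : ℝ≥0) := by
  induction N with
  | zero => simp [majorantIterate, normE]
  | succ N ih =>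
    rw [majorantIterate, normE_add, normE_sum, normE_mul, normE_mul, normE_C]
    have h1 : ∑ l : Fin n, normE r (MvPowerSeries.X l : MvPowerSeries (Fin n) ℝ≥0∞) ≤
        (n * r : ℝ≥0) := by
      refine (Finset.sum_le_sum fun l _ => normE_X_le (r : ℝ≥0∞) l).trans ?_
      simp
    have h2 : β * ((2 * (n * r)) * (2 * (n * r))) ≤ n * r :=
      calc β * ((2 * (n * r)) * (2 * (n * r))) = β * (4 * (n * r)) * (n * r) := by ring
        _ ≤ 1 * (n * r) := by gcongr
        _ = n * r := one_mul _
    calc _ ≤ ((n * r : ℝ≥0) : ℝ≥0∞) + β * ((2 * (n * r) : ℝ≥0) * (2 * (n * r) : ℝ≥0)) := by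
          gcongr
      _ = ((n * r + β * ((2 * (n * r)) * (2 * (n * r))) : ℝ≥0) : ℝ≥0∞) := by push_cast; rfl
      _ ≤ (2 * (n * r) : ℝ≥0) := by
          rw [ENNReal.coe_le_coe]
          calc n * r + β * ((2 * (n * r)) * (2 * (n * r))) ≤ n * r + n * r := by gcongr
            _ = 2 * (n * r) := by ring

/-- Separation of the small divisors from the combinatorics: a solution of the recursive inequality
`A_Q ≤ cost(Q) [∑_{d ≥ 2} (b A)^d]_Q` is bounded by the solution without divisors times the worst
product of divisors over a tree. -/
theorem coeff_le_majorantIterate_mul_treeSup {n : ℕ} {A : MvPowerSeries (Fin n) ℝ≥0∞} {b : ℝ≥0}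
    {cost : (Fin n →₀ ℕ) → ℝ≥0∞} (hA0 : MvPowerSeries.coeff 0 A = 0)
    (hA1 : ∀ l, MvPowerSeries.coeff (Finsupp.single l 1) A ≤ 1)
    (hA : ∀ Q : Fin n →₀ ℕ, 2 ≤ Q.degree →
      MvPowerSeries.coeff Q A ≤ cost Q * MvPowerSeries.coeff Q (geomTail b A)) (N : ℕ) :
    ∀ Q : Fin n →₀ ℕ, Q.degree ≤ N →
      MvPowerSeries.coeff Q A ≤
        MvPowerSeries.coeff Q (majorantIterate n (b * (b + 1)) N) * treeSup cost true Q ∧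
      MvPowerSeries.coeff Q (geomTail b A) ≤
        MvPowerSeries.coeff Q (majorantIterate n (b * (b + 1)) N) * treeSup cost false Q := by
  classical
  have hG0 : MvPowerSeries.coeff 0 (geomTail (b : ℝ≥0∞) A) = 0 := by
    rw [coeff_geomTail_eq_sum]
    simp [hA0]
  induction N with
  | zero =>
    intro Q hQ
    rw [(Finsupp.degree_eq_zero_iff Q).mp (Nat.le_zero.mp hQ), hA0, hG0]
    exact ⟨zero_le, zero_le⟩
  | succ N ih =>
    intro Q hQ
    have hcoeff : MvPowerSeries.coeff Q (majorantIterate n (b * (b + 1)) (N + 1)) =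
        MvPowerSeries.coeff Q (∑ l, MvPowerSeries.X l : MvPowerSeries (Fin n) ℝ≥0∞) +
        ((b * (b + 1) : ℝ≥0) : ℝ≥0∞) * MvPowerSeries.coeff Q
          (majorantIterate n (b * (b + 1)) N * majorantIterate n (b * (b + 1)) N) := by
      rw [majorantIterate, map_add, MvPowerSeries.coeff_C_mul]
    have hG : MvPowerSeries.coeff Q (geomTail b A) ≤
        MvPowerSeries.coeff Q (majorantIterate n (b * (b + 1)) (N + 1)) *
          treeSup cost false Q := by
      refine le_trans ?_ (mul_le_mul_left (hcoeff ▸ le_add_self) _)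
      rw [coeff_geomTail_eq_sum, MvPowerSeries.coeff_mul, Finset.mul_sum, Finset.sum_mul]
      refine Finset.sum_le_sum fun p hp => ?_
      have hpQ := Finset.HasAntidiagonal.mem_antidiagonal.mp hp
      have hdeg : p.1.degree + p.2.degree = Q.degree := by rw [← hpQ, map_add]
      by_cases h1 : p.1 = 0
      · rw [h1, hA0, mul_zero, zero_mul]; exact zero_le
      by_cases h2 : p.2 = 0
      · rw [h2, hA0, hG0, mul_zero, add_zero, mul_zero]; exact zero_le
      have h1' : p.1.degree ≠ 0 := fun h => h1 ((Finsupp.degree_eq_zero_iff _).mp h)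
      have h2' : p.2.degree ≠ 0 := fun h => h2 ((Finsupp.degree_eq_zero_iff _).mp h)
      obtain ⟨a1, -⟩ := ih p.1 (by omega)
      obtain ⟨a2, g2⟩ := ih p.2 (by omega)
      set κ := majorantIterate n (b * (b + 1)) N
      have t1 := treeSup_mul_le cost true p.1 p.2
      have t2 := treeSup_mul_le cost false p.1 p.2
      rw [hpQ] at t1 t2
      calc _ ≤ (b : ℝ≥0∞) * (MvPowerSeries.coeff p.1 κ * treeSup cost true p.1) *
            (b * (MvPowerSeries.coeff p.2 κ * treeSup cost true p.2) +
              MvPowerSeries.coeff p.2 κ * treeSup cost false p.2) := by gcongr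
        _ = b * (MvPowerSeries.coeff p.1 κ * MvPowerSeries.coeff p.2 κ) *
            (b * (treeSup cost true p.1 * treeSup cost true p.2) +
              treeSup cost true p.1 * treeSup cost false p.2) := by ring
        _ ≤ b * (MvPowerSeries.coeff p.1 κ * MvPowerSeries.coeff p.2 κ) *
            (b * treeSup cost false Q + treeSup cost false Q) := by gcongr
        _ = _ := by push_cast; ring
    refine ⟨?_, hG⟩
    rcases lt_or_ge Q.degree 2 with hlt | hge
    · by_cases h0 : Q = 0
      · rw [h0, hA0]; exact zero_le
      · obtain ⟨l, P, rfl⟩ := exists_eq_single_add h0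
        rw [map_add, Finsupp.degree_single] at hlt
        have hP : P = 0 := (Finsupp.degree_eq_zero_iff P).mp (by omega)
        rw [hP, add_zero] at hcoeff ⊢
        refine (hA1 l).trans ?_
        rw [← one_mul (1 : ℝ≥0∞)]
        refine mul_le_mul' ?_ (by simpa using le_treeSup cost (DivisorTree.leaf l))
        rw [hcoeff, map_sum]
        refine le_trans (le_trans ?_ (Finset.single_le_sum (fun _ _ => zero_le)
          (Finset.mem_univ l))) le_self_add
        simp [MvPowerSeries.coeff_X]
    · refine (hA Q hge).trans ((mul_le_mul_right hG _).trans ?_)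
      rw [mul_left_comm]
      exact mul_le_mul_right (cost_mul_treeSup_le cost Q) _

/-- The majorant without divisors converges for `r` small, and replacing `r` by `r / K` absorbs
the products of the divisors. -/
theorem exists_normE_ne_top_of_recursion {n : ℕ} {A : MvPowerSeries (Fin n) ℝ≥0∞} {b K : ℝ≥0}
    {cost : (Fin n →₀ ℕ) → ℝ≥0∞} (hA0 : MvPowerSeries.coeff 0 A = 0)
    (hA1 : ∀ l, MvPowerSeries.coeff (Finsupp.single l 1) A ≤ 1)
    (hA : ∀ Q : Fin n →₀ ℕ, 2 ≤ Q.degree →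
      MvPowerSeries.coeff Q A ≤ cost Q * MvPowerSeries.coeff Q (geomTail b A))
    (hK : 0 < K)
    (hT : ∀ Q N, DivisorTree true Q N → (N.map cost).prod ≤ (K : ℝ≥0∞) ^ Q.degree) :
    ∃ r : ℝ≥0, 0 < r ∧ normE r A ≠ ∞ := by
  set β := b * (b + 1)
  set r : ℝ≥0 := (4 * (n + 1) * (β + 1))⁻¹ with hr
  have hr0 : 0 < r := by positivity
  have hβ : β * (4 * (n * r)) ≤ 1 := by
    calc β * (4 * (n * r)) = (4 * n * β) * r := by ring
      _ ≤ (4 * (n + 1) * (β + 1)) * r := by gcongr <;> exact le_self_add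
      _ = 1 := mul_inv_cancel₀ (by positivity)
  refine ⟨r / K, by positivity, ne_top_of_le_ne_top
    (ENNReal.coe_ne_top (r := 2 * (n * r))) ?_⟩
  rw [normE, ENNReal.tsum_eq_iSup_sum]
  refine iSup_le fun s => ?_
  obtain ⟨N, hN⟩ : ∃ N, ∀ Q ∈ s, Q.degree ≤ N :=
    ⟨s.sup Finsupp.degree, fun Q hQ => Finset.le_sup (f := Finsupp.degree) hQ⟩
  refine le_trans (le_trans (Finset.sum_le_sum fun Q hQ => ?_) (ENNReal.sum_le_tsum s))
    (normE_majorantIterate_le hβ N)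
  have h1 := (coeff_le_majorantIterate_mul_treeSup hA0 hA1 hA N Q (hN Q hQ)).1
  have h2 : treeSup cost true Q ≤ (K : ℝ≥0∞) ^ Q.degree := iSup₂_le fun N h => hT Q N h
  have h3 : (K : ℝ≥0∞) * ((r / K : ℝ≥0) : ℝ≥0∞) = r := by
    rw [← ENNReal.coe_mul, mul_div_cancel₀ _ hK.ne']
  calc _ ≤ MvPowerSeries.coeff Q (majorantIterate n β N) * (K : ℝ≥0∞) ^ Q.degree *
        ((r / K : ℝ≥0) : ℝ≥0∞) ^ Q.degree := by
        gcongr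
        exact h1.trans (by gcongr)
    _ = _ := by rw [mul_assoc, ← mul_pow, h3]

/-- Convergence of a map tangent to the identity whose coefficients satisfy the recursion of the
linearization equation, up to factors `cost` with geometrically bounded products over trees. -/
theorem isConvergent_of_recursion {n : ℕ} {ι : Type*} [Finite ι] {f : ι → FormalMap n}
    (hf : ∀ p k, IsConvergent (f p k)) (hf2 : ∀ p k, f p k ∈ suppIdeal (degGE n 2))
    {Ψ : FormalMap n} (hΨ : IsTangentToId Ψ) {cost : (Fin n →₀ ℕ) → ℝ≥0∞} {K : ℝ≥0}
    (hK : 0 < K)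
    (hT : ∀ Q N, DivisorTree true Q N → (N.map cost).prod ≤ (K : ℝ≥0∞) ^ Q.degree)
    (hrec : ∀ Q : Fin n →₀ ℕ, 2 ≤ Q.degree → ∀ k, ∃ p,
      ‖MvPowerSeries.coeff Q (Ψ k)‖ₑ ≤
        cost Q * ‖MvPowerSeries.coeff Q (MvPowerSeries.subst Ψ (f p k))‖ₑ) (k : Fin n) :
    IsConvergent (Ψ k) := by
  classical
  choose b hb using fun p k => exists_subst_le_geomTail (hf p k) (hf2 p k)
  obtain ⟨B, hB⟩ : ∃ B : ℝ≥0, ∀ p k, b p k ≤ B := by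
    have := Fintype.ofFinite ι
    exact ⟨∑ p, ∑ k, b p k, fun p k => le_trans
      (Finset.single_le_sum (f := fun k => b p k) (fun _ _ => zero_le) (Finset.mem_univ k))
      (Finset.single_le_sum (f := fun p => ∑ k, b p k) (fun _ _ => zero_le)
        (Finset.mem_univ p))⟩
  let A : MvPowerSeries (Fin n) ℝ≥0∞ := fun Q => ⨆ k, ‖MvPowerSeries.coeff Q (Ψ k)‖ₑ
  have hAc : ∀ Q, MvPowerSeries.coeff Q A = ⨆ k, ‖MvPowerSeries.coeff Q (Ψ k)‖ₑ := fun _ => rfl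
  have hle : ∀ k Q, ‖MvPowerSeries.coeff Q (Ψ k)‖ₑ ≤ MvPowerSeries.coeff Q A :=
    fun k Q => le_iSup (fun k => ‖MvPowerSeries.coeff Q (Ψ k)‖ₑ) k
  suffices h : ∃ r : ℝ≥0, 0 < r ∧ normE r A ≠ ∞ by
    obtain ⟨r, hr, hAr⟩ := h
    exact (isConvergent_iff_normE _).mpr ⟨r, hr, ne_top_of_le_ne_top hAr
      (normE_mono le_rfl (hle k))⟩
  refine exists_normE_ne_top_of_recursion (A := A) (b := B) (cost := cost) ?_ ?_ ?_ hK hT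
  · rw [hAc]
    refine le_antisymm (iSup_le fun k => ?_) zero_le
    rw [MvPowerSeries.coeff_zero_eq_constantCoeff_apply, hΨ.1 k, enorm_zero]
  · intro l
    rw [hAc]
    refine iSup_le fun k => ?_
    have h : MvPowerSeries.coeff (Finsupp.single l 1) (Ψ k) = (1 : Matrix _ _ ℂ) k l :=
      congrFun (congrFun hΨ.2 k) l
    rw [h, Matrix.one_apply]
    split_ifs <;> simp
  · intro Q hQ
    rw [hAc]
    refine iSup_le fun k => ?_
    obtain ⟨p, hp⟩ := hrec Q hQ k
    refine hp.trans ?_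
    gcongr
    refine (enorm_coeff_subst_le hΨ.1 hle _ Q).trans ((hb p k A Q).trans
      (geomTail_mono (by exact_mod_cast hB p k) A Q))

/-- The inverse of a convergent map tangent to the identity is convergent. -/
theorem isConvergent_inverse {n : ℕ} {Φ Ψ : FormalMap n} (hΨ : IsTangentToId Ψ)
    (hΦ : IsTangentToId Φ) (hc : ∀ k, IsConvergent (Ψ k)) (hinv : comp Ψ Φ = idMap n)
    (k : Fin n) : IsConvergent (Φ k) := by
  refine isConvergent_of_recursion (ι := Unit) (cost := fun _ => 1) (K := 1)
    (f := fun _ k => MvPowerSeries.X k - Ψ k)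
    (fun _ k => (isConvergent_monomial _ _).sub (hc k))
    (fun _ k => ?_) hΦ one_pos (fun Q N _ => by simp) (fun Q hQ k => ⟨(), ?_⟩) k
  · have h := neg_mem (hΨ.sub_X_mem k)
    rwa [neg_sub] at h
  · have h : MvPowerSeries.subst Φ (Ψ k) = MvPowerSeries.X k := congrFun hinv k
    have hX : MvPowerSeries.coeff Q (MvPowerSeries.X k : Formal n) = 0 := by
      classical
      rw [MvPowerSeries.coeff_X, if_neg]
      rintro rfl
      simp at hQ
    have hs := hΦ.vanishesAtZero.hasSubst
    rw [MvPowerSeries.subst_sub hs, MvPowerSeries.subst_X hs, h, map_sub, hX, sub_zero, one_mul]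

/-! ### Small divisors -/

theorem powQ_add {n : ℕ} (μ : Fin n → ℂ) (P Q : Fin n →₀ ℕ) :
    powQ μ (P + Q) = powQ μ P * powQ μ Q := by
  simp [powQ, pow_add, Finset.prod_mul_distrib]

theorem powQ_single {n : ℕ} (μ : Fin n → ℂ) (l : Fin n) :
    powQ μ (Finsupp.single l 1) = μ l := by
  classical
  rw [powQ, Finset.prod_eq_single l]
  · simp
  · intro k _ hk
    rw [Finsupp.single_eq_of_ne hk, pow_zero]
  · simp

section Divisors

variable {ι : Type} [Fintype ι] {n : ℕ} (μ : ι → Fin n → ℂ)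

theorem norm_le_maxDivisor (Q : Fin n →₀ ℕ) (j : Fin n) (p : ι) :
    ‖powQ (μ p) Q - μ p j‖ ≤ maxDivisor μ Q j :=
  le_ciSup (f := fun p => ‖powQ (μ p) Q - μ p j‖) (Set.finite_range _).bddAbove p

theorem maxDivisor_nonneg (Q : Fin n →₀ ℕ) (j : Fin n) : 0 ≤ maxDivisor μ Q j :=
  Real.iSup_nonneg fun _ => norm_nonneg _

theorem exists_maxDivisor_eq [Nonempty ι] (Q : Fin n →₀ ℕ) (j : Fin n) :
    ∃ p, ‖powQ (μ p) Q - μ p j‖ = maxDivisor μ Q j :=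
  exists_eq_ciSup_of_finite

theorem maxDivisor_pos {Q : Fin n →₀ ℕ} {j : Fin n} (h : ∃ p, powQ (μ p) Q ≠ μ p j) :
    0 < maxDivisor μ Q j := by
  obtain ⟨p, hp⟩ := h
  exact (norm_pos_iff.mpr (sub_ne_zero.mpr hp)).trans_le (norm_le_maxDivisor μ Q j p)

variable {μ} {E : Set (Fin n →₀ ℕ)}

theorem omega_le {k : ℕ} {Q : Fin n →₀ ℕ} (h2 : 2 ≤ Q.degree) (hk : Q.degree ≤ 2 ^ k)
    (hE : Q ∈ E) {j : Fin n} (hpos : 0 < maxDivisor μ Q j) :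
    omega μ E k ≤ maxDivisor μ Q j := by
  refine csInf_le ⟨0, ?_⟩ ⟨hpos.ne', Q, j, h2, hk, hE, rfl⟩
  rintro d ⟨-, P, i, -, -, -, rfl⟩
  exact maxDivisor_nonneg μ P i

theorem omega_pos {k : ℕ} {Q : Fin n →₀ ℕ} (h2 : 2 ≤ Q.degree) (hk : Q.degree ≤ 2 ^ k)
    (hE : Q ∈ E) {j : Fin n} (hpos : 0 < maxDivisor μ Q j) : 0 < omega μ E k := by
  set D := {d : ℝ | d ≠ 0 ∧ ∃ (Q : Fin n →₀ ℕ) (j : Fin n),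
    2 ≤ Q.degree ∧ Q.degree ≤ 2 ^ k ∧ Q ∈ E ∧ d = maxDivisor μ Q j} with hD
  have hne : D.Nonempty := ⟨_, hpos.ne', Q, j, h2, hk, hE, rfl⟩
  have hfin : D.Finite := by
    refine (((Finsupp.finite_of_degree_le (σ := Fin n) (2 ^ k)).prod
      (Set.finite_univ (α := Fin n))).image
      fun q => maxDivisor μ q.1 q.2).subset ?_
    rintro d ⟨-, P, i, -, hP, -, rfl⟩
    exact ⟨(P, i), ⟨hP, Set.mem_univ i⟩, rfl⟩
  obtain ⟨hne, P, i, -, -, -, hd⟩ : omega μ E k ∈ D := hne.csInf_mem hfin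
  exact lt_of_le_of_ne (by rw [hd]; exact maxDivisor_nonneg μ P i) hne.symm

/-- The hypotheses under which small divisors are estimated: `U` is the upper set of exponents that
are left out, there are no resonances outside `U`, and the eigenvalues do not vanish. -/
structure IsNonResonantOff (μ : ι → Fin n → ℂ) (U : UpperSet (Fin n →₀ ℕ)) : Prop where
  ne_zero : ∀ p k, μ p k ≠ 0
  exists_ne : ∀ Q ∉ U, 2 ≤ Q.degree → ∀ k, ∃ p, powQ (μ p) Q ≠ μ p k

variable {U : UpperSet (Fin n →₀ ℕ)}

theorem IsNonResonantOff.exists_threshold (hμ : IsNonResonantOff μ U) :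
    ∃ θ : ℝ, 0 < θ ∧ θ ≤ 1 ∧ (∀ p j, 2 * θ ≤ ‖μ p j‖) ∧
      ∀ p j s, 4 * θ * ‖μ p s‖ ≤ ‖μ p j‖ := by
  have h1 : ∀ c d : ℝ, 0 < d → ∀ᶠ θ in 𝓝[>] (0 : ℝ), θ * c ≤ d := by
    intro c d hd
    have : Tendsto (fun θ : ℝ => θ * c) (𝓝[>] 0) (𝓝 (0 * c)) :=
      (tendsto_id.mono_left nhdsWithin_le_nhds).mul_const c
    rw [zero_mul] at this
    exact this.eventually (Iic_mem_nhds hd)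
  have hpos : ∀ p j, 0 < ‖μ p j‖ := fun p j => norm_pos_iff.mpr (hμ.ne_zero p j)
  have e1 : ∀ᶠ θ in 𝓝[>] (0 : ℝ), ∀ p j, θ * 2 ≤ ‖μ p j‖ :=
    eventually_all.mpr fun p => eventually_all.mpr fun j => h1 _ _ (hpos p j)
  have e2 : ∀ᶠ θ in 𝓝[>] (0 : ℝ), ∀ p j s, θ * (4 * ‖μ p s‖) ≤ ‖μ p j‖ :=
    eventually_all.mpr fun p => eventually_all.mpr fun j => eventually_all.mpr fun s =>
      h1 _ _ (hpos p j)
  obtain ⟨θ, h0, h3, h4, h5⟩ :=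
    (eventually_mem_nhdsWithin.and
      ((h1 1 1 one_pos).and (e1.and e2))).exists
  exact ⟨θ, h0, by linarith, fun p j => by linarith [h4 p j],
    fun p j s => by linarith [h5 p j s]⟩

/-- The divisors of `(Q, j)` fall below the fraction `θ` of the level `k`. -/
def IsSmall (μ : ι → Fin n → ℂ) (U : UpperSet (Fin n →₀ ℕ)) (E : Set (Fin n →₀ ℕ)) (θ : ℝ)
    (k : ℕ) (j : Fin n) (Q : Fin n →₀ ℕ) : Prop :=
  Q ∉ U ∧ 2 ≤ Q.degree ∧ maxDivisor μ Q j < θ * min (omega μ E k) 1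

theorem IsSmall.lt_degree {θ : ℝ} {k : ℕ} {j : Fin n} {Q : Fin n →₀ ℕ}
    (hμ : IsNonResonantOff μ U) (hE : ∀ Q ∉ U, Q ∈ E) (hθ : 0 < θ) (hθ1 : θ ≤ 1)
    (h : IsSmall μ U E θ k j Q) : 2 ^ k < Q.degree := by
  obtain ⟨hQ, h2, hlt⟩ := h
  by_contra! hle
  have hpos := maxDivisor_pos μ (hμ.exists_ne Q hQ h2 j)
  have h1 := omega_le (E := E) h2 hle (hE Q hQ) hpos
  have h3 : 0 < min (omega μ E k) 1 := lt_min (omega_pos h2 hle (hE Q hQ) hpos) one_pos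
  have h4 := min_le_left (omega μ E k) 1
  nlinarith

/-- Two small divisors at the same level and for the same component are far apart: their quotient
gives an exponent whose divisors are smaller than the level allows in low degrees. That exponent is
`Q' - Q + e_s`, and for `x_s` dividing `x^Q` it divides `Q'`, so that it is not left out either. -/
theorem IsSmall.degree_add_le {θ : ℝ} [Nonempty ι] {k : ℕ} {j : Fin n} {Q Q' : Fin n →₀ ℕ}
    (hμ : IsNonResonantOff μ U) (hE : ∀ Q ∉ U, Q ∈ E) (hθ : 0 < θ)
    (hθ2 : ∀ p j, 2 * θ ≤ ‖μ p j‖) (hθ4 : ∀ p j s, 4 * θ * ‖μ p s‖ ≤ ‖μ p j‖)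
    (h : IsSmall μ U E θ k j Q) (h' : IsSmall μ U E θ k j Q') (hle : Q ≤ Q') (hne : Q ≠ Q') :
    Q.degree + 2 ^ k ≤ Q'.degree := by
  obtain ⟨R, rfl⟩ := exists_add_of_le hle
  obtain ⟨hQ, h2, hlt⟩ := h
  obtain ⟨hQ', -, hlt'⟩ := h'
  have hR : R.degree ≠ 0 := by
    intro h0
    rw [(Finsupp.degree_eq_zero_iff R).mp h0, add_zero] at hne
    exact hne rfl
  obtain ⟨s, P, hQP⟩ := exists_eq_single_add (P := Q) (by rintro rfl; simp at h2)
  set T := R + Finsupp.single s 1 with hT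
  have hTU : T ∉ U := fun hmem => hQ' (U.upper (by
    rw [hT, hQP, add_comm R, add_right_comm]
    exact le_self_add) hmem)
  have hTdeg : T.degree = R.degree + 1 := by rw [hT, map_add, Finsupp.degree_single]
  rw [map_add]
  by_contra! hcon
  have hT2 : 2 ≤ T.degree := by omega
  have hTpos := maxDivisor_pos μ (hμ.exists_ne T hTU hT2 s)
  have hω := omega_le (E := E) (k := k) hT2 (by omega) (hE T hTU) hTpos
  obtain ⟨p, hp⟩ := exists_maxDivisor_eq μ T s
  rw [← hp] at hω
  set o := min (omega μ E k) 1 with ho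
  have ho1 : o ≤ 1 := min_le_right _ _
  have hoω : o ≤ omega μ E k := min_le_left _ _
  have a1 := (norm_le_maxDivisor μ Q j p).trans_lt hlt
  have a2 := (norm_le_maxDivisor μ (Q + R) j p).trans_lt hlt'
  set a := powQ (μ p) Q
  have b1 : ‖μ p j‖ / 2 ≤ ‖a‖ := by
    have := norm_sub_norm_le (μ p j) a
    rw [norm_sub_rev] at this
    have := hθ2 p j
    nlinarith
  have b2 : ‖powQ (μ p) (Q + R) - a‖ < 2 * θ * o := by
    have := norm_sub_le_norm_sub_add_norm_sub (powQ (μ p) (Q + R)) (μ p j) a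
    rw [norm_sub_rev (μ p j) a] at this
    linarith
  have hj : 0 < ‖μ p j‖ := norm_pos_iff.mpr (hμ.ne_zero p j)
  have hs : 0 < ‖μ p s‖ := norm_pos_iff.mpr (hμ.ne_zero p s)
  have hid : (powQ (μ p) T - μ p s) * a = μ p s * (powQ (μ p) (Q + R) - a) := by
    rw [hT, powQ_add, powQ_add, powQ_single]; ring
  have hnorm : ‖powQ (μ p) T - μ p s‖ * ‖a‖ = ‖μ p s‖ * ‖powQ (μ p) (Q + R) - a‖ := by
    rw [← norm_mul, hid, norm_mul]
  have ho0 : 0 < o := by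
    by_contra! hle0
    have := norm_nonneg (powQ (μ p) (Q + R) - a)
    nlinarith
  have c1 : ‖powQ (μ p) T - μ p s‖ * ‖a‖ < o * ‖a‖ := by
    rw [hnorm]
    calc ‖μ p s‖ * ‖powQ (μ p) (Q + R) - a‖ < ‖μ p s‖ * (2 * θ * o) := by gcongr
      _ = (4 * θ * ‖μ p s‖) * (o / 2) := by ring
      _ ≤ ‖μ p j‖ * (o / 2) := by gcongr; exact hθ4 p j s
      _ = o * (‖μ p j‖ / 2) := by ring
      _ ≤ o * ‖a‖ := by gcongr
  have := lt_of_mul_lt_mul_right c1 (norm_nonneg a)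
  linarith

/-- The logarithmic weight that bounds the inverse divisors of an exponent of degree at most `K`:
level `k + 2` is paid for by the divisors that are small at level `k + 1`. -/
noncomputable def logWeight (μ : ι → Fin n → ℂ) (U : UpperSet (Fin n →₀ ℕ))
    (E : Set (Fin n →₀ ℕ)) (θ : ℝ) (K : ℕ) (Q : Fin n →₀ ℕ) : ℝ :=
  open Classical in
  (-Real.log θ + |Real.log (omega μ E 1)|) + ∑ k ∈ Finset.range K, ∑ j,
    if IsSmall μ U E θ (k + 1) j Q then |Real.log (omega μ E (k + 2))| else 0

theorem inv_le_exp {ω θ d : ℝ} (hω : 0 < ω) (hθ : 0 < θ) (h : θ * min ω 1 ≤ d) :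
    d⁻¹ ≤ Real.exp (-Real.log θ + |Real.log ω|) := by
  have ho : 0 < min ω 1 := lt_min hω one_pos
  have hlog : -|Real.log ω| ≤ Real.log (min ω 1) := by
    rcases le_total ω 1 with h1 | h1
    · rw [min_eq_left h1]; exact neg_abs_le _
    · rw [min_eq_right h1, Real.log_one]; linarith [abs_nonneg (Real.log ω)]
  calc d⁻¹ ≤ (θ * min ω 1)⁻¹ := by gcongr
    _ = Real.exp (-(Real.log θ + Real.log (min ω 1))) := by
        rw [← Real.log_mul hθ.ne' ho.ne', Real.exp_neg, Real.exp_log (by positivity)]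
    _ ≤ _ := Real.exp_le_exp.mpr (by linarith)

theorem inv_maxDivisor_le_exp {θ : ℝ} (hμ : IsNonResonantOff μ U) (hE : ∀ Q ∉ U, Q ∈ E)
    (hθ : 0 < θ) (hθ1 : θ ≤ 1) {K : ℕ} {Q : Fin n →₀ ℕ} (hQ : Q ∉ U) (h2 : 2 ≤ Q.degree)
    (hK : Q.degree ≤ K) (j : Fin n) :
    (maxDivisor μ Q j)⁻¹ ≤ Real.exp (logWeight μ U E θ K Q) := by
  classical
  have hω : ∀ k, 0 < omega μ E (k + 1) := by
    -- some exponent of degree exactly two divides `Q`, and its divisors bound every level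
    intro k
    obtain ⟨s, P, rfl⟩ := exists_eq_single_add (P := Q) (by rintro rfl; simp at h2)
    rw [map_add, Finsupp.degree_single] at h2
    obtain ⟨t, R, rfl⟩ := exists_eq_single_add (P := P) (by rintro rfl; simp at h2)
    have hT : Finsupp.single s 1 + Finsupp.single t 1 ∉ U := fun h => hQ (U.upper (by
      rw [← add_assoc]; exact le_self_add) h)
    have hdeg : (Finsupp.single s 1 + Finsupp.single t 1 : Fin n →₀ ℕ).degree = 2 := by
      rw [map_add, Finsupp.degree_single, Finsupp.degree_single]
    refine omega_pos hdeg.ge ?_ (hE _ hT) (maxDivisor_pos μ (hμ.exists_ne _ hT hdeg.ge j))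
    rw [hdeg, pow_succ]
    have := Nat.one_le_two_pow (n := k)
    omega
  have hterm : ∀ k j, 0 ≤ if IsSmall μ U E θ (k + 1) j Q then
      |Real.log (omega μ E (k + 2))| else 0 := fun k j => by
    split_ifs <;> positivity
  have hex : ∃ k, θ * min (omega μ E (k + 1)) 1 ≤ maxDivisor μ Q j ∧ k ≤ K := by
    refine ⟨K, ?_, le_rfl⟩
    by_contra! hlt
    have h3 := IsSmall.lt_degree hμ hE hθ hθ1 (⟨hQ, h2, hlt⟩ : IsSmall μ U E θ (K + 1) j Q)
    have := Nat.lt_two_pow_self (n := K + 1)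
    omega
  obtain ⟨hk, hkK⟩ := Nat.find_spec hex
  refine (inv_le_exp (hω _) hθ hk).trans (Real.exp_le_exp.mpr ?_)
  rw [logWeight]
  rcases hfind : Nat.find hex with _ | k
  · have : 0 ≤ ∑ k ∈ Finset.range K, ∑ j,
        if IsSmall μ U E θ (k + 1) j Q then |Real.log (omega μ E (k + 2))| else 0 :=
      Finset.sum_nonneg fun k _ => Finset.sum_nonneg fun j _ => hterm k j
    rw [zero_add]
    linarith
  · rw [hfind] at hkK
    have hsmall : IsSmall μ U E θ (k + 1) j Q := by
      refine ⟨hQ, h2, ?_⟩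
      have := Nat.find_min hex (m := k) (by omega)
      rw [not_and_or] at this
      exact not_le.mp (this.resolve_right (by omega))
    have h3 : |Real.log (omega μ E (k + 2))| ≤ ∑ k ∈ Finset.range K, ∑ j,
        if IsSmall μ U E θ (k + 1) j Q then |Real.log (omega μ E (k + 2))| else 0 := by
      refine le_trans ?_ (Finset.single_le_sum (fun k _ => Finset.sum_nonneg fun j _ => hterm k j)
        (Finset.mem_range.mpr (show k < K by omega)))
      refine le_trans ?_ (Finset.single_le_sum (fun j _ => hterm k j) (Finset.mem_univ j))
      rw [if_pos hsmall]
    have := abs_nonneg (Real.log (omega μ E 1))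
    rw [show k + 1 + 1 = k + 2 by rfl]
    linarith

theorem sum_logWeight {θ : ℝ} {K : ℕ} (N : Multiset (Fin n →₀ ℕ)) :
    open Classical in
    (N.map (logWeight μ U E θ K)).sum =
      Multiset.card N * (-Real.log θ + |Real.log (omega μ E 1)|) +
        ∑ k ∈ Finset.range K, ∑ j,
          N.countP (IsSmall μ U E θ (k + 1) j) * |Real.log (omega μ E (k + 2))| := by
  classical
  induction N using Multiset.induction_on with
  | empty => simp
  | cons Q N ih =>
    rw [Multiset.map_cons, Multiset.sum_cons, ih, Multiset.card_cons, logWeight]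
    simp only [Multiset.countP_cons, Nat.cast_add, add_mul, Finset.sum_add_distrib,
      Nat.cast_ite, Nat.cast_one, Nat.cast_zero, ite_mul, one_mul, zero_mul]
    ring

/-- The largest inverse divisor of an exponent, and `0` for the exponents that are left out. -/
noncomputable def divisorCost (μ : ι → Fin n → ℂ) (U : UpperSet (Fin n →₀ ℕ))
    (Q : Fin n →₀ ℕ) : ℝ≥0∞ :=
  open Classical in if Q ∈ U then 0 else ⨆ j, ENNReal.ofReal (maxDivisor μ Q j)⁻¹

theorem prod_le_ofReal_exp {cost : (Fin n →₀ ℕ) → ℝ≥0∞} {v : (Fin n →₀ ℕ) → ℝ}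
    (N : Multiset (Fin n →₀ ℕ)) (h : ∀ Q ∈ N, cost Q ≤ ENNReal.ofReal (Real.exp (v Q))) :
    (N.map cost).prod ≤ ENNReal.ofReal (Real.exp (N.map v).sum) := by
  induction N using Multiset.induction_on with
  | empty => simp
  | cons Q N ih =>
    rw [Multiset.map_cons, Multiset.prod_cons, Multiset.map_cons, Multiset.sum_cons, Real.exp_add,
      ENNReal.ofReal_mul (Real.exp_pos _).le]
    exact mul_le_mul' (h Q (Multiset.mem_cons_self Q N))
      (ih fun P hP => h P (Multiset.mem_cons_of_mem hP))

/-- Under the diophantine condition the products of the inverse divisors over a tree are bounded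
geometrically in the degree of the root. -/
theorem exists_prod_divisorCost_le [Nonempty ι] (hμ : IsNonResonantOff μ U)
    (hE : ∀ Q ∉ U, Q ∈ E) (hd : IsDiophantine μ E) :
    ∃ K : ℝ≥0, 0 < K ∧ ∀ Q N, DivisorTree true Q N →
      (N.map (divisorCost μ U)).prod ≤ (K : ℝ≥0∞) ^ Q.degree := by
  classical
  obtain ⟨θ, hθ, hθ1, hθ2, hθ4⟩ := hμ.exists_threshold
  set ℓ : ℕ → ℝ := fun k => |Real.log (omega μ E k)| with hℓ
  have hsum : Summable fun k : ℕ => ℓ (k + 1) / 2 ^ (k + 1) := by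
    refine hd.abs.congr fun k => ?_
    rw [abs_div, abs_neg, abs_of_pos (by positivity : (0 : ℝ) < 2 ^ (k + 1))]
  set S := ∑' k : ℕ, ℓ (k + 1) / 2 ^ (k + 1) with hS
  set c : ℝ := -Real.log θ + ℓ 1 with hc
  have hc0 : 0 ≤ c := by
    have := Real.log_nonpos hθ.le hθ1
    have : 0 ≤ ℓ 1 := abs_nonneg _
    linarith
  refine ⟨⟨Real.exp (c + 4 * n * S), (Real.exp_pos _).le⟩, Real.exp_pos _, fun Q N hT => ?_⟩
  have hcost : ∀ P ∈ N, divisorCost μ U P ≤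
      ENNReal.ofReal (Real.exp (logWeight μ U E θ Q.degree P)) := by
    intro P hP
    obtain ⟨h2, hPQ⟩ := hT.degree_mem P hP
    rw [divisorCost]
    split_ifs with hPU
    · exact zero_le
    · exact iSup_le fun j => ENNReal.ofReal_le_ofReal
        (inv_maxDivisor_le_exp hμ hE hθ hθ1 hPU h2 hPQ j)
  refine (prod_le_ofReal_exp N hcost).trans ?_
  have hbound : (N.map (logWeight μ U E θ Q.degree)).sum ≤ Q.degree * (c + 4 * n * S) := by
    rw [sum_logWeight, mul_add (Q.degree : ℝ)]
    refine add_le_add ?_ ?_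
    · have h1 := hT.card_le
      have h2 : (Multiset.card N : ℝ) ≤ Q.degree := by
        exact_mod_cast (Nat.le_add_right (Multiset.card N) _).trans h1
      exact mul_le_mul_of_nonneg_right h2 hc0
    · have hcount : ∀ k j, (N.countP (IsSmall μ U E θ (k + 1) j) : ℝ) * ℓ (k + 2) ≤
          4 * Q.degree * (ℓ (k + 2) / 2 ^ (k + 2)) := by
        intro k j
        have h1 := hT.mul_countP_le (m := 2 ^ (k + 1)) (small := IsSmall μ U E θ (k + 1) j)
          (fun P hP => hP.lt_degree hμ hE hθ hθ1)
          (fun P P' hP hP' => hP.degree_add_le hμ hE hθ hθ2 hθ4 hP')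
        have h2 : (2 : ℝ) ^ (k + 1) * N.countP (IsSmall μ U E θ (k + 1) j) ≤ 2 * Q.degree := by
          exact_mod_cast h1
        have h3 : 0 ≤ ℓ (k + 2) := abs_nonneg _
        have h4 : (N.countP (IsSmall μ U E θ (k + 1) j) : ℝ) ≤
            2 * Q.degree / 2 ^ (k + 1) := by
          rw [le_div_iff₀ (by positivity)]; linarith
        refine (mul_le_mul_of_nonneg_right h4 h3).trans (le_of_eq ?_)
        rw [pow_succ (2 : ℝ) (k + 1)]
        field_simp
        ring
      refine (Finset.sum_le_sum fun k _ => Finset.sum_le_sum fun j _ => hcount k j).trans ?_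
      simp only [Finset.sum_const, Finset.card_univ, Fintype.card_fin, nsmul_eq_mul]
      rw [← Finset.mul_sum, ← Finset.mul_sum]
      have hpart : ∑ k ∈ Finset.range Q.degree, ℓ (k + 2) / 2 ^ (k + 2) ≤ S := by
        have h5 := ((summable_nat_add_iff 1).mpr hsum).sum_le_tsum (Finset.range Q.degree)
          fun k _ => by positivity
        refine h5.trans ?_
        rw [hS, hsum.tsum_eq_zero_add]
        have : 0 ≤ ℓ (0 + 1) / 2 ^ (0 + 1) := by positivity
        linarith
      calc (n : ℝ) * (4 * Q.degree * ∑ k ∈ Finset.range Q.degree, ℓ (k + 2) / 2 ^ (k + 2))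
          ≤ n * (4 * Q.degree * S) := by gcongr
        _ = Q.degree * (4 * n * S) := by ring
  calc _ ≤ ENNReal.ofReal (Real.exp (Q.degree * (c + 4 * n * S))) :=
        ENNReal.ofReal_le_ofReal (Real.exp_le_exp.mpr hbound)
    _ = _ := by
        rw [Real.exp_nat_mul, ENNReal.ofReal_pow (Real.exp_pos _).le]
        congr 1
        exact ENNReal.ofReal_eq_coe_nnreal _

end Divisors

/-! ### Monomial ideals -/

theorem mono_add {n : ℕ} (P Q : Fin n →₀ ℕ) : mono (P + Q) = mono P * mono Q := by
  refine Subtype.ext ?_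
  change MvPowerSeries.monomial (P + Q) (1 : ℂ) =
    MvPowerSeries.monomial P 1 * MvPowerSeries.monomial Q 1
  rw [MvPowerSeries.monomial_mul_monomial, one_mul]

/-- The exponents of the monomials that belong to `I`. -/
def idealExponents {n : ℕ} (I : Ideal (Holo n)) : UpperSet (Fin n →₀ ℕ) where
  carrier := {Q | mono Q ∈ I}
  upper' P Q hPQ hP := by
    obtain ⟨R, rfl⟩ := exists_add_of_le hPQ
    change mono (P + R) ∈ I
    rw [mono_add]
    exact I.mul_mem_right _ hP

theorem mem_idealExponents {n : ℕ} {I : Ideal (Holo n)} {Q : Fin n →₀ ℕ} :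
    Q ∈ idealExponents I ↔ mono Q ∈ I := Iff.rfl

theorem coe_mem_suppIdeal {n : ℕ} {I : Ideal (Holo n)} (hI : IsMonomialIdeal I) {h : Holo n}
    (hh : h ∈ I) : (h : Formal n) ∈ suppIdeal (idealExponents I) := by
  classical
  obtain ⟨A, hA⟩ := hI
  have hle : I ≤ (suppIdeal (idealExponents I)).comap (Holo n).val := by
    conv_lhs => rw [hA]
    rw [Ideal.span_le]
    rintro _ ⟨R, hR, rfl⟩ Q hQ
    change MvPowerSeries.coeff Q (MvPowerSeries.monomial R (1 : ℂ)) = 0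
    refine MvPowerSeries.coeff_monomial_ne ?_ 1
    rintro rfl
    exact hQ (mem_idealExponents.mpr (hA ▸ Ideal.subset_span ⟨Q, hR, rfl⟩))
  exact hle hh

theorem formalIdeal_le {n : ℕ} {I : Ideal (Holo n)} (hI : IsMonomialIdeal I) :
    formalIdeal I ≤ suppIdeal (idealExponents I) := by
  rw [formalIdeal, Ideal.map_le_iff_le_comap]
  exact fun h hh => coe_mem_suppIdeal hI hh

/-- A convergent series all of whose exponents are those of monomials of `I` lies in `I`: by
Dickson's lemma, finitely many minimal monomials suffice to divide its terms. -/
theorem memIdeal_of_mem_suppIdeal {n : ℕ} {I : Ideal (Holo n)} {f : Formal n}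
    (hf : IsConvergent f) (hI : f ∈ suppIdeal (idealExponents I)) : MemIdeal I f := by
  classical
  set U := idealExponents I with hU
  have hfin : {Q | Minimal (· ∈ U) Q}.Finite :=
    WellQuasiOrderedLE.finite_of_isAntichain (setOfPred_minimal_antichain _)
  choose! ρ hρle hρ using fun (Q : Fin n →₀ ℕ) (hQ : Q ∈ U) =>
    exists_minimal_le_of_wellFoundedLT (· ∈ U) Q hQ
  let part : (Fin n →₀ ℕ) → Formal n := fun R P =>
    if ρ (P + R) = R then MvPowerSeries.coeff (P + R) f else 0
  have hpart : ∀ R, IsConvergent (part R) := by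
    intro R
    obtain ⟨r, hr, h⟩ := hf
    refine ⟨r, hr, ?_⟩
    have h1 := (h.comp_injective (add_left_injective R)).mul_left ((r ^ R.degree)⁻¹)
    refine Summable.of_nonneg_of_le (fun P => by positivity) (fun P => ?_) h1
    have h2 : ‖MvPowerSeries.coeff P (part R)‖ ≤ ‖MvPowerSeries.coeff (P + R) f‖ := by
      change ‖if ρ (P + R) = R then MvPowerSeries.coeff (P + R) f else 0‖ ≤ _
      split_ifs <;> simp
    have h3 : (r ^ R.degree)⁻¹ * (‖MvPowerSeries.coeff (P + R) f‖ * r ^ (P + R).degree) =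
        ‖MvPowerSeries.coeff (P + R) f‖ * r ^ P.degree := by
      rw [map_add, pow_add]; field_simp
    simp only [Function.comp_apply]
    rw [h3]
    gcongr
  refine ⟨∑ R ∈ hfin.toFinset, mono R * ⟨part R, hpart R⟩, Ideal.sum_mem _ fun R hR => ?_, ?_⟩
  · rw [Set.Finite.mem_toFinset] at hR
    exact I.mul_mem_right _ hR.1
  · rw [AddSubmonoidClass.coe_finsetSum]
    ext Q
    have hterm : ∀ R, MvPowerSeries.coeff Q ((mono R * (⟨part R, hpart R⟩ : Holo n) : Holo n) :
        Formal n) = if R ≤ Q ∧ ρ Q = R then MvPowerSeries.coeff Q f else 0 := by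
      intro R
      change MvPowerSeries.coeff Q (MvPowerSeries.monomial R (1 : ℂ) * part R) = _
      rw [MvPowerSeries.coeff_monomial_mul]
      by_cases hRQ : R ≤ Q
      · rw [if_pos hRQ, one_mul]
        change (if ρ (Q - R + R) = R then MvPowerSeries.coeff (Q - R + R) f else 0) = _
        rw [tsub_add_cancel_of_le hRQ]
        simp [hRQ]
      · rw [if_neg hRQ, if_neg fun h => hRQ h.1]
    rw [map_sum, Finset.sum_congr rfl fun R _ => hterm R]
    by_cases hQ : Q ∈ U
    · rw [Finset.sum_eq_single (ρ Q)]
      · rw [if_pos ⟨hρle Q hQ, rfl⟩]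
      · intro R _ hR
        rw [if_neg fun h => hR h.2.symm]
      · intro h
        rw [Set.Finite.mem_toFinset] at h
        exact absurd (hρ Q hQ) h
    · rw [hI Q hQ]; simp

theorem isConvergent_linearMap {n : ℕ} (A : Matrix (Fin n) (Fin n) ℂ) (k : Fin n) :
    IsConvergent (linearMap A k) :=
  (Holo n).sum_mem fun l _ => (Holo n).smul_mem (isConvergent_monomial _ _) (A k l)

theorem subst_linearMap_mul {n : ℕ} (A B : Matrix (Fin n) (Fin n) ℂ) (f : Formal n) :
    MvPowerSeries.subst (linearMap (A * B)) f =
      MvPowerSeries.subst (linearMap B) (MvPowerSeries.subst (linearMap A) f) := by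
  rw [← comp_linearMap]
  exact (MvPowerSeries.subst_comp_subst_apply (vanishesAtZero_linearMap A).hasSubst
    (vanishesAtZero_linearMap B).hasSubst f).symm

/-! ### The linear parts of the involutions -/

section Linear

variable {n m : ℕ} {S : Fin m → Fin n → Holo n}

theorem antiLinearPart_mul_conj (hS : ∀ i, IsAntiInvolution (S i)) (i : Fin m) :
    antiLinearPart (S i) * (antiLinearPart (S i)).map (starRingEnd ℂ) = 1 := by
  have h0 : VanishesAtZero (toFormal (S i)) := (hS i).1
  rw [antiLinearPart, ← linearPart_conjMap, ← linearPart_comp h0 h0.conjMap, (hS i).2,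
    linearPart_idMap]

theorem conj_mul_antiLinearPart (hS : ∀ i, IsAntiInvolution (S i)) (i : Fin m) :
    (antiLinearPart (S i)).map (starRingEnd ℂ) * antiLinearPart (S i) = 1 :=
  mul_eq_one_comm.mp (antiLinearPart_mul_conj hS i)

theorem pairLinear_eq_diagonal (hdiag : ∀ i j, (pairLinear S i j).IsDiag) (i j : Fin m) :
    pairLinear S i j = Matrix.diagonal (eigenvalue S (i, j)) :=
  (hdiag i j).diagonal_diag.symm

theorem pairLinear_mul_swap (hS : ∀ i, IsAntiInvolution (S i)) (i j : Fin m) :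
    pairLinear S i j * pairLinear S j i = 1 := by
  rw [pairLinear, pairLinear, Matrix.mul_assoc, ← Matrix.mul_assoc _ (antiLinearPart (S j)),
    conj_mul_antiLinearPart hS, Matrix.one_mul, antiLinearPart_mul_conj hS]

theorem eigenvalue_ne_zero (hS : ∀ i, IsAntiInvolution (S i))
    (hdiag : ∀ i j, (pairLinear S i j).IsDiag) (p : Fin m × Fin m) (k : Fin n) :
    eigenvalue S p k ≠ 0 := by
  intro h
  have h1 := congrFun (congrFun (pairLinear_mul_swap hS p.1 p.2) k) k
  rw [pairLinear_eq_diagonal hdiag, Matrix.diagonal_mul, Matrix.one_apply_eq] at h1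
  rw [h, zero_mul] at h1
  exact zero_ne_one h1

/-- The antilinear involution `B_i` conjugates `D_{ij}` to its inverse. -/
theorem pairLinear_mul_mul_conj (hS : ∀ i, IsAntiInvolution (S i)) (i j : Fin m) :
    pairLinear S i j * antiLinearPart (S i) * (pairLinear S i j).map (starRingEnd ℂ) =
      antiLinearPart (S i) := by
  have h1 : (pairLinear S i j).map (starRingEnd ℂ) =
      (antiLinearPart (S i)).map (starRingEnd ℂ) * antiLinearPart (S j) := by
    rw [pairLinear, Matrix.map_mul, Matrix.map_map]
    congr 1
    ext k l
    simp
  rw [h1, Matrix.mul_assoc, ← Matrix.mul_assoc (antiLinearPart (S i)),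
    antiLinearPart_mul_conj hS, Matrix.one_mul, pairLinear, Matrix.mul_assoc,
    conj_mul_antiLinearPart hS, Matrix.mul_one]

theorem conj_pairLinear_mul_mul (hS : ∀ i, IsAntiInvolution (S i)) (i j : Fin m) :
    (pairLinear S i j).map (starRingEnd ℂ) * (antiLinearPart (S i)).map (starRingEnd ℂ) *
      pairLinear S i j = (antiLinearPart (S i)).map (starRingEnd ℂ) := by
  have h := congrArg (fun A => A.map (starRingEnd ℂ)) (pairLinear_mul_mul_conj hS i j)
  simp only [Matrix.map_mul, Matrix.map_map] at h
  convert h using 2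
  ext k l
  simp

theorem conj_pairLinear_eq_diagonal (hdiag : ∀ i j, (pairLinear S i j).IsDiag) (i j : Fin m) :
    (pairLinear S i j).map (starRingEnd ℂ) =
      Matrix.diagonal fun l => starRingEnd ℂ (eigenvalue S (i, j) l) := by
  rw [pairLinear_eq_diagonal hdiag]
  exact Matrix.diagonal_map (map_zero _)

theorem powQ_conj (μ : Fin n → ℂ) (Q : Fin n →₀ ℕ) :
    powQ (fun l => starRingEnd ℂ (μ l)) Q = starRingEnd ℂ (powQ μ Q) := by
  simp [powQ]

/-- The non-resonance condition on the involutions excludes every resonance of the linear parts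
outside `I`. Indeed `x^Q ∘ B̄_i` is a combination of monomials `x^P` with
`μ_{ij}^P = (μ̄_{ij}^Q)⁻¹` for all `j`. If `Q` were resonant, all these `P` would violate the
condition on the involutions, hence have `x^P ∈ I`, and so would `x^Q = x^Q ∘ B̄_i ∘ B_i`. -/
theorem exists_powQ_ne (hS : ∀ i, IsAntiInvolution (S i))
    (hdiag : ∀ i j, (pairLinear S i j).IsDiag) {I : Ideal (Holo n)}
    (hIB : ∀ i, IsInvariantUnder I (antiLinearPart (S i)))
    (hnonres : IsNonResonantOn S I) {Q : Fin n →₀ ℕ} (hQ2 : 2 ≤ Q.degree) (hQ : mono Q ∉ I)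
    (i : Fin m) (k : Fin n) : ∃ j, powQ (eigenvalue S (i, j)) Q ≠ eigenvalue S (i, j) k := by
  classical
  by_contra! hres
  set B := antiLinearPart (S i) with hB
  set x : Formal n := MvPowerSeries.monomial Q 1 with hx
  set f := MvPowerSeries.subst (linearMap (B.map (starRingEnd ℂ))) x with hf
  have hfconv : IsConvergent f := (isConvergent_monomial Q 1).subst
    (vanishesAtZero_linearMap _) fun l => isConvergent_linearMap _ l
  have hcoeff : ∀ j P, MvPowerSeries.coeff P f = powQ (eigenvalue S (i, j)) P *
      (starRingEnd ℂ (eigenvalue S (i, j) k) * MvPowerSeries.coeff P f) := by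
    intro j P
    have h1 : MvPowerSeries.subst (linearMap ((pairLinear S i j).map (starRingEnd ℂ))) x =
        starRingEnd ℂ (eigenvalue S (i, j) k) • x := by
      ext R
      rw [conj_pairLinear_eq_diagonal hdiag, coeff_subst_diagonal, map_smul, smul_eq_mul, hx,
        MvPowerSeries.coeff_monomial]
      split_ifs with hR
      · rw [hR, powQ_conj, hres j]
      · simp
    conv_lhs => rw [hf, hB, ← conj_pairLinear_mul_mul hS i j, subst_linearMap_mul,
      subst_linearMap_mul, h1, MvPowerSeries.subst_smul (vanishesAtZero_linearMap _).hasSubst,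
      pairLinear_eq_diagonal hdiag, coeff_subst_diagonal, map_smul, smul_eq_mul]
  have hfI : f ∈ suppIdeal (idealExponents I) := by
    intro P hP
    by_contra hfP
    have hP2 : 2 ≤ P.degree := by
      by_contra hlt
      refine hfP (subst_mem_degGE (d := 2) (vanishesAtZero_linearMap _) ?_ P hlt)
      intro R hR
      refine MvPowerSeries.coeff_monomial_ne ?_ 1
      rintro rfl
      exact hR hQ2
    obtain ⟨j, hj⟩ := hnonres P hP2 hP i k
    refine hj (eq_inv_of_mul_eq_one_left ?_)
    have h2 : powQ (eigenvalue S (i, j)) P * starRingEnd ℂ (eigenvalue S (i, j) k) = 1 := by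
      refine mul_right_cancel₀ hfP ?_
      rw [one_mul, mul_assoc]
      exact (hcoeff j P).symm
    have h3 := congrArg (starRingEnd ℂ) h2
    rwa [map_mul, Complex.conj_conj, map_one, ← powQ_conj] at h3
  obtain ⟨h, hh, hhf⟩ := memIdeal_of_mem_suppIdeal hfconv hfI
  obtain ⟨g, hg, hgx⟩ := hIB i h hh
  rw [hhf, hf, ← subst_linearMap_mul, hB, conj_mul_antiLinearPart hS, linearMap_one] at hgx
  have : MvPowerSeries.subst (idMap n) x = x := congrFun (MvPowerSeries.subst_self (R := ℂ)) x
  rw [this] at hgx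
  have hgm : g = mono Q := Subtype.ext hgx
  exact hQ (hgm ▸ hg)

end Linear

/-! ### The linearization equation -/

section Schroeder

variable {n m : ℕ} {S : Fin m → Fin n → Holo n}

theorem IsConvergent.map_conj {f : Formal n} (hf : IsConvergent f) :
    IsConvergent (MvPowerSeries.map (starRingEnd ℂ) f) := by
  obtain ⟨r, hr, h⟩ := hf
  refine ⟨r, hr, h.congr fun Q => ?_⟩
  rw [MvPowerSeries.coeff_map, RCLike.norm_conj]

theorem conjMap_linearMap (A : Matrix (Fin n) (Fin n) ℂ) :
    conjMap (linearMap A) = linearMap (A.map (starRingEnd ℂ)) := by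
  classical
  funext k
  ext Q
  simp [conjMap, linearMap, MvPowerSeries.coeff_X, apply_ite (starRingEnd ℂ)]

theorem vanishesAtZero_involution (hS : ∀ i, IsAntiInvolution (S i)) (i : Fin m) :
    VanishesAtZero (toFormal (S i)) := (hS i).1

theorem vanishesAtZero_pairMap (hS : ∀ i, IsAntiInvolution (S i)) (i j : Fin m) :
    VanishesAtZero (pairMap S i j) :=
  (vanishesAtZero_involution hS i).comp (vanishesAtZero_involution hS j).conjMap

theorem isConvergent_pairMap (hS : ∀ i, IsAntiInvolution (S i)) (i j k) :
    IsConvergent (pairMap S i j k) :=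
  IsConvergent.subst (S i k).2 (vanishesAtZero_involution hS j).conjMap
    fun l => IsConvergent.map_conj (S j l).2

theorem linearPart_pairMap (hS : ∀ i, IsAntiInvolution (S i)) (i j : Fin m) :
    linearPart (pairMap S i j) = pairLinear S i j := by
  rw [pairMap, linearPart_comp (vanishesAtZero_involution hS i)
    (vanishesAtZero_involution hS j).conjMap, linearPart_conjMap]
  rfl

/-- In terms of the inverse `Ψ` of the linearizing map, linearization modulo the ideal reads
`F ∘ Ψ ≡ Ψ ∘ D`, and this does not change when terms of the ideal are dropped from `Ψ`. -/
theorem exists_formal_solution (hS : ∀ i, IsAntiInvolution (S i))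
    (hdiag : ∀ i j, (pairLinear S i j).IsDiag) {I : Ideal (Holo n)} (hI : IsMonomialIdeal I)
    (hformal : IsFormallyLinearizableOn S I) :
    ∃ Ψ : FormalMap n, IsTangentToId Ψ ∧
      (∀ Q ∈ idealExponents I, 2 ≤ Q.degree → ∀ k, MvPowerSeries.coeff Q (Ψ k) = 0) ∧
      ∀ i j k, comp (pairMap S i j) Ψ k - comp Ψ (linearMap (pairLinear S i j)) k ∈
        suppIdeal (idealExponents I) := by
  classical
  obtain ⟨Φ, Θ, hΦ, hinv, hΘ0, -, hlin⟩ := hformal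
  set U := idealExponents I with hU
  have hΘv : VanishesAtZero Θ := hΘ0
  have hΘ : IsTangentToId Θ := by
    refine ⟨hΘ0, ?_⟩
    have h := linearPart_comp hΦ.1 hΘv
    rwa [hinv.1, linearPart_idMap, hΦ.2, one_mul, eq_comm] at h
  have hsol : ∀ i j k, comp (pairMap S i j) Θ k - comp Θ (linearMap (pairLinear S i j)) k ∈
      suppIdeal U := by
    intro i j k
    have hF := vanishesAtZero_pairMap hS i j
    have hmem : MemGroup S (pairMap S i j) := by
      have := MemGroup.mul i j (idMap n) (MemGroup.one (S := S))
      rwa [comp_idMap] at this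
    have h1 : ∀ k, comp Φ (comp (pairMap S i j) Θ) k - linearMap (pairLinear S i j) k ∈
        suppIdeal U := fun k => by
      rw [← linearPart_pairMap hS]
      exact formalIdeal_le hI (hlin _ hmem k)
    have h2 := subst_sub_subst_mem (VanishesAtZero.comp hΦ.1 (hF.comp hΘv))
      (vanishesAtZero_linearMap _) h1 (Θ k)
    have h3 : comp Θ (comp Φ (comp (pairMap S i j) Θ)) = comp (pairMap S i j) Θ := by
      rw [← comp_assoc _ hΦ.1 (hF.comp hΘv), hinv.2, idMap_comp (hF.comp hΘv)]
    rw [← h3]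
    exact h2
  let Ψ : FormalMap n := fun k Q =>
    if Q ∈ U ∧ 2 ≤ Q.degree then 0 else MvPowerSeries.coeff Q (Θ k)
  have hc : ∀ k Q, MvPowerSeries.coeff Q (Ψ k) =
      if Q ∈ U ∧ 2 ≤ Q.degree then 0 else MvPowerSeries.coeff Q (Θ k) := fun _ _ => rfl
  have hU' : ∀ k, Ψ k - Θ k ∈ suppIdeal U := fun k Q hQ => by
    rw [map_sub, hc, if_neg fun h => hQ h.1, sub_self]
  have h2 : ∀ k, Ψ k - Θ k ∈ suppIdeal (degGE n 2) := fun k Q hQ => by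
    rw [map_sub, hc, if_neg fun h => hQ h.2, sub_self]
  have hΨ : IsTangentToId Ψ := isTangentToId_of_sub_X_mem fun k => by
    have := add_mem (h2 k) (hΘ.sub_X_mem k)
    rwa [sub_add_sub_cancel] at this
  refine ⟨Ψ, hΨ, fun Q hQ hQ2 k => by rw [hc, if_pos ⟨hQ, hQ2⟩], fun i j k => ?_⟩
  have e1 := subst_sub_subst_mem hΨ.1 hΘv hU' (pairMap S i j k)
  have e2 := subst_diagonal_mem (eigenvalue S (i, j)) (hU' k)
  rw [← pairLinear_eq_diagonal hdiag,
    MvPowerSeries.subst_sub (vanishesAtZero_linearMap _).hasSubst] at e2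
  have h := sub_mem (add_mem e1 (hsol i j k)) e2
  convert h using 1
  simp only [comp]
  ring

theorem subst_linearMap_diagonal (d : Fin n → ℂ) {g : FormalMap n} (hg : VanishesAtZero g)
    (k : Fin n) : MvPowerSeries.subst g (linearMap (Matrix.diagonal d) k) = d k • g k := by
  rw [linearMap_diagonal, MvPowerSeries.subst_smul hg.hasSubst, MvPowerSeries.subst_X hg.hasSubst]

/-- The solution converges: its coefficients outside the ideal satisfy
`(μ_p^Q - μ_{p,k}) Ψ_{Q,k} = [f_{p,k}(Ψ)]_Q` for all pairs `p`, where `f_p` is the nonlinear part of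
`F_p`, and for each of them a pair with the largest divisor can be used. -/
theorem isConvergent_of_linearization (hm : Nonempty (Fin m))
    (hS : ∀ i, IsAntiInvolution (S i)) (hdiag : ∀ i j, (pairLinear S i j).IsDiag)
    {U : UpperSet (Fin n →₀ ℕ)} (hμ : IsNonResonantOff (eigenvalue S) U)
    {E : Set (Fin n →₀ ℕ)} (hE : ∀ Q ∉ U, Q ∈ E) (hd : IsDiophantine (eigenvalue S) E)
    {Ψ : FormalMap n} (hΨ : IsTangentToId Ψ)
    (hΨU : ∀ Q ∈ U, 2 ≤ Q.degree → ∀ k, MvPowerSeries.coeff Q (Ψ k) = 0)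
    (hsol : ∀ i j k, comp (pairMap S i j) Ψ k - comp Ψ (linearMap (pairLinear S i j)) k ∈
      suppIdeal U) (k : Fin n) : IsConvergent (Ψ k) := by
  obtain ⟨K, hK, hT⟩ := exists_prod_divisorCost_le hμ hE hd
  refine isConvergent_of_recursion (ι := Fin m × Fin m)
    (f := fun p k => pairMap S p.1 p.2 k - linearMap (pairLinear S p.1 p.2) k)
    (fun p k => (isConvergent_pairMap hS _ _ k).sub (isConvergent_linearMap _ k))
    (fun p k => sub_linearMap_mem (vanishesAtZero_pairMap hS _ _) (linearPart_pairMap hS _ _) k)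
    hΨ hK hT (fun Q hQ2 k => ?_) k
  by_cases hQ : Q ∈ U
  · obtain ⟨i⟩ := hm
    exact ⟨(i, i), by rw [hΨU Q hQ hQ2 k, enorm_zero]; exact zero_le⟩
  · obtain ⟨p, hp⟩ := exists_maxDivisor_eq (eigenvalue S) Q k
    refine ⟨p, ?_⟩
    have hpos := maxDivisor_pos (eigenvalue S) (hμ.exists_ne Q hQ hQ2 k)
    have h1 := hsol p.1 p.2 k Q hQ
    rw [map_sub, sub_eq_zero] at h1
    have h2 : MvPowerSeries.coeff Q (MvPowerSeries.subst Ψ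
        (pairMap S p.1 p.2 k - linearMap (pairLinear S p.1 p.2) k)) =
        (powQ (eigenvalue S p) Q - eigenvalue S p k) * MvPowerSeries.coeff Q (Ψ k) := by
      rw [MvPowerSeries.subst_sub hΨ.vanishesAtZero.hasSubst, map_sub,
        show MvPowerSeries.coeff Q (MvPowerSeries.subst Ψ (pairMap S p.1 p.2 k)) = _ from h1,
        pairLinear_eq_diagonal hdiag, subst_linearMap_diagonal _ hΨ.1, map_smul, smul_eq_mul,
        comp, coeff_subst_diagonal]
      ring
    rw [h2, enorm_mul, ← mul_assoc]
    have h3 : 1 ≤ divisorCost (eigenvalue S) U Q *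
        ‖powQ (eigenvalue S p) Q - eigenvalue S p k‖ₑ := by
      rw [divisorCost, if_neg hQ, ← ofReal_norm, hp]
      calc (1 : ℝ≥0∞) = ENNReal.ofReal (maxDivisor (eigenvalue S) Q k)⁻¹ *
            ENNReal.ofReal (maxDivisor (eigenvalue S) Q k) := by
            rw [← ENNReal.ofReal_mul (inv_nonneg.mpr hpos.le), inv_mul_cancel₀ hpos.ne',
              ENNReal.ofReal_one]
        _ ≤ _ := by
            gcongr
            exact le_iSup (fun j => ENNReal.ofReal (maxDivisor (eigenvalue S) Q j)⁻¹) k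
    exact le_mul_of_one_le_left zero_le h3

/-! ### Linearization of the group and of the involutions -/

/-- The properties of the elements of the group that are inherited by products. -/
theorem MemGroup.linearization (hS : ∀ i, IsAntiInvolution (S i))
    (hdiag : ∀ i j, (pairLinear S i j).IsDiag) {U : UpperSet (Fin n →₀ ℕ)} {Ψ : FormalMap n}
    (hΨ : VanishesAtZero Ψ)
    (hsol : ∀ i j k, comp (pairMap S i j) Ψ k - comp Ψ (linearMap (pairLinear S i j)) k ∈
      suppIdeal U) {g : FormalMap n} (hg : MemGroup S g) :
    VanishesAtZero g ∧ (∀ k, IsConvergent (g k)) ∧ (∃ d, linearPart g = Matrix.diagonal d) ∧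
      ∀ k, comp g Ψ k - comp Ψ (linearMap (linearPart g)) k ∈ suppIdeal U := by
  induction hg with
  | one =>
    refine ⟨vanishesAtZero_idMap n, fun k => isConvergent_monomial _ _,
      ⟨fun _ => 1, by rw [linearPart_idMap, Matrix.diagonal_one]⟩, fun k => ?_⟩
    rw [linearPart_idMap, linearMap_one, comp_idMap, idMap_comp hΨ, sub_self]
    exact zero_mem _
  | mul i j g _ ih =>
    obtain ⟨hg0, hgc, ⟨d, hd⟩, hgΨ⟩ := ih
    have hF := vanishesAtZero_pairMap hS i j
    have hlin : linearPart (comp (pairMap S i j) g) = pairLinear S i j * linearPart g := by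
      rw [linearPart_comp hF hg0, linearPart_pairMap hS]
    have hL := vanishesAtZero_linearMap (linearPart g)
    refine ⟨hF.comp hg0, fun k => (isConvergent_pairMap hS i j k).subst hg0 hgc,
      ⟨fun k => eigenvalue S (i, j) k * d k, ?_⟩, fun k => ?_⟩
    · rw [hlin, hd, pairLinear_eq_diagonal hdiag, Matrix.diagonal_mul_diagonal]
    · have e1 := subst_sub_subst_mem (hg0.comp hΨ) (hΨ.comp hL) hgΨ (pairMap S i j k)
      have e2 := subst_diagonal_mem d (hsol i j k)
      rw [← hd, MvPowerSeries.subst_sub hL.hasSubst] at e2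
      have h := add_mem e1 e2
      have a1 : comp (comp (pairMap S i j) g) Ψ = comp (pairMap S i j) (comp g Ψ) :=
        comp_assoc _ hg0 hΨ
      have a2 : comp (comp (pairMap S i j) Ψ) (linearMap (linearPart g)) =
          comp (pairMap S i j) (comp Ψ (linearMap (linearPart g))) := comp_assoc _ hΨ hL
      have a3 : comp Ψ (linearMap (linearPart (comp (pairMap S i j) g))) =
          comp (comp Ψ (linearMap (pairLinear S i j))) (linearMap (linearPart g)) := by
        rw [hlin, ← comp_linearMap, comp_assoc _ (vanishesAtZero_linearMap _) hL]
      rw [a1, a3]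
      convert h using 1
      have a2k := congrFun a2 k
      simp only [comp] at a2k ⊢
      rw [a2k]
      ring

theorem comp_comp_sub_linearMap_mem {U : UpperSet (Fin n →₀ ℕ)} {Φ Ψ g : FormalMap n}
    {A : Matrix (Fin n) (Fin n) ℂ} (hg : VanishesAtZero g) (hΨ : VanishesAtZero Ψ)
    (hinv : comp Φ Ψ = idMap n)
    (h : ∀ k, comp g Ψ k - comp Ψ (linearMap A) k ∈ suppIdeal U) (k : Fin n) :
    comp Φ (comp g Ψ) k - linearMap A k ∈ suppIdeal U := by
  have hA := vanishesAtZero_linearMap A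
  have h1 := subst_sub_subst_mem (hg.comp hΨ) (hΨ.comp hA) h (Φ k)
  have h2 : comp Φ (comp Ψ (linearMap A)) = linearMap A := by
    rw [← comp_assoc _ hΨ hA, hinv, idMap_comp hA]
  rw [← congrFun h2 k]
  exact h1

theorem conj_comp_involution (hS : ∀ i, IsAntiInvolution (S i)) (i : Fin m) :
    comp (conjMap (toFormal (S i))) (toFormal (S i)) = idMap n := by
  have h0 := vanishesAtZero_involution hS i
  have h := congrArg conjMap (hS i).2
  rwa [conjMap_comp _ h0.conjMap, conjMap_conjMap, conjMap_idMap] at h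

/-- `F_{ij} ∘ ρ_i ∘ F_{ij} = ρ_i`. -/
theorem pairMap_comp_involution_comp (hS : ∀ i, IsAntiInvolution (S i)) (i j : Fin m) :
    comp (pairMap S i j) (comp (toFormal (S i)) (conjMap (pairMap S i j))) = toFormal (S i) := by
  have hi := vanishesAtZero_involution hS i
  have hj := vanishesAtZero_involution hS j
  have h1 : comp (toFormal (S i)) (conjMap (pairMap S i j)) = toFormal (S j) := by
    rw [pairMap, conjMap_comp _ hj.conjMap, conjMap_conjMap, ← comp_assoc _ hi.conjMap hj,
      (hS i).2, idMap_comp hj]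
  rw [h1, pairMap, comp_assoc _ hj.conjMap hj, conj_comp_involution hS, comp_idMap]

/-- An antiholomorphic map `T` with `H_j ∘ T ∘ H_j = T`, where `H_j = D_j` modulo the ideal, is
antilinear modulo the ideal. By induction on the degree `|Q|`, the coefficient of `z̄^Q` in the
`k`-th component is multiplied by `μ_{j,k} μ̄_j^Q`, which differs from `1` for some `j`. -/
theorem sub_linearMap_mem_of_conjugation {ι : Type*} {U : UpperSet (Fin n →₀ ℕ)}
    {T : FormalMap n} {B : Matrix (Fin n) (Fin n) ℂ} (hT : VanishesAtZero T)
    (hTB : linearPart T = B) {H : ι → FormalMap n} {μ : ι → Fin n → ℂ}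
    (hH : ∀ j, VanishesAtZero (H j)) (hHT : ∀ j, comp (H j) (comp T (conjMap (H j))) = T)
    (hHlin : ∀ j, linearPart (H j) = Matrix.diagonal (μ j))
    (hHU : ∀ j k, H j k - linearMap (Matrix.diagonal (μ j)) k ∈ suppIdeal U)
    (hBU : ∀ j k, MvPowerSeries.subst (linearMap B)
      (H j k - linearMap (Matrix.diagonal (μ j)) k) ∈ suppIdeal U)
    (hnonres : ∀ Q ∉ U, 2 ≤ Q.degree → ∀ k, ∃ j,
      μ j k * powQ (fun l => starRingEnd ℂ (μ j l)) Q ≠ 1) (k : Fin n) :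
    T k - linearMap B k ∈ suppIdeal U := by
  have key : ∀ d, 2 ≤ d → ∀ k, T k - linearMap B k ∈ suppIdeal (U ⊓ degGE n d) := by
    intro d hd
    induction d, hd using Nat.le_induction with
    | base =>
      exact fun k => suppIdeal_mono (fun Q hQ => UpperSet.mem_inf_iff.mpr (Or.inr hQ))
        (sub_linearMap_mem hT hTB k)
    | succ d hd ih =>
      intro k Q hQ
      rw [UpperSet.mem_inf_iff, not_or, mem_degGE, not_le, Nat.lt_succ_iff] at hQ
      obtain ⟨hQU, hQd⟩ := hQ
      rcases hQd.lt_or_eq with hlt | heq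
      · exact ih k Q fun h => (UpperSet.mem_inf_iff.mp h).elim hQU fun h => hlt.not_ge h
      obtain ⟨j, hj⟩ := hnonres Q hQU (heq ▸ hd) k
      rw [map_sub, coeff_linearMap_of_degree_ne_one B k (by omega), sub_zero]
      set ν : Fin n → ℂ := fun l => starRingEnd ℂ (μ j l) with hν
      set L := linearMap (Matrix.diagonal ν) with hL
      have hL0 : VanishesAtZero L := vanishesAtZero_linearMap _
      have hHc : ∀ l, conjMap (H j) l - L l ∈ suppIdeal U := by
        intro l P hP
        have e : L = conjMap (linearMap (Matrix.diagonal (μ j))) := by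
          rw [conjMap_linearMap, Matrix.diagonal_map (map_zero _)]
        have := hHU j l P hP
        rw [map_sub, sub_eq_zero] at this
        rw [e, map_sub, conjMap, conjMap, MvPowerSeries.coeff_map, MvPowerSeries.coeff_map, this,
          sub_self]
      set T' := comp T (conjMap (H j)) with hT'
      have hT'0 : VanishesAtZero T' := hT.comp (hH j).conjMap
      have e1 : ∀ l, T' l - MvPowerSeries.subst L (T l) ∈ suppIdeal U := fun l =>
        subst_sub_subst_mem (hH j).conjMap hL0 hHc (T l)
      have hW0 : VanishesAtZero (comp (linearMap B) L) := (vanishesAtZero_linearMap B).comp hL0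
      have e2 : ∀ l, T' l - comp (linearMap B) L l ∈ suppIdeal (U ⊓ degGE n d) := by
        intro l
        have h1 := subst_diagonal_mem ν (ih l)
        rw [MvPowerSeries.subst_sub hL0.hasSubst] at h1
        have h2 := add_mem (suppIdeal_mono
          (fun P hP => UpperSet.mem_inf_iff.mpr (Or.inl hP)) (e1 l)) h1
        rwa [sub_add_sub_cancel] at h2
      have e3 := subst_sub_subst_mem_of_order (V := U ⊓ degGE n (d + 1)) hT'0 hW0 e2
        (sub_linearMap_mem (hH j) (hHlin j) k) (fun P hP R hR => by
          rw [UpperSet.mem_inf_iff] at hP ⊢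
          refine hP.imp (fun h => U.upper le_self_add h) fun h => ?_
          rw [mem_degGE] at *
          rw [map_add]; omega) Q (fun h => (UpperSet.mem_inf_iff.mp h).elim hQU
            fun h => by rw [mem_degGE] at h; omega)
      have e4 : MvPowerSeries.subst (comp (linearMap B) L)
          (H j k - linearMap (Matrix.diagonal (μ j)) k) ∈ suppIdeal U := by
        have h := subst_diagonal_mem ν (hBU j k)
        rwa [MvPowerSeries.subst_comp_subst_apply (vanishesAtZero_linearMap B).hasSubst
          hL0.hasSubst] at h
      rw [map_sub, e4 Q hQU, sub_zero, MvPowerSeries.subst_sub hT'0.hasSubst, map_sub,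
        subst_linearMap_diagonal _ hT'0, map_smul, smul_eq_mul, sub_eq_zero] at e3
      have e5 := e1 k Q hQU
      rw [map_sub, coeff_subst_diagonal, sub_eq_zero] at e5
      have e6 : MvPowerSeries.coeff Q (MvPowerSeries.subst T' (H j k)) =
          MvPowerSeries.coeff Q (T k) := by
        conv_rhs => rw [← hHT j]
        rfl
      rw [e6, e5, ← mul_assoc] at e3
      by_contra hne
      exact hj (mul_right_cancel₀ hne (by rw [one_mul]; exact e3.symm))
  intro Q hQ
  refine key (Q.degree + 2) (by omega) k Q fun h => (UpperSet.mem_inf_iff.mp h).elim hQ fun h => ?_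
  rw [mem_degGE] at h
  omega

end Schroeder

end TotallyReal

open TotallyReal in
theorem mainTheorem4 (n m : ℕ)
    (M : Fin m → Set (Fin n → ℂ)) (S : Fin m → Fin n → Holo n)
    (hM : ∀ i, IsTotallyRealGerm (M i))
    (hS : ∀ i, IsAntiInvolution (S i))
    (hfix : ∀ i, IsFixedSet (S i) (M i))
    (hcomm : ∀ g h, MemGroup S g → MemGroup S h → comp g h = comp h g)
    (hdiag : ∀ i j, (pairLinear S i j).IsDiag)
    (I : Ideal (Holo n)) (hI : IsMonomialIdeal I)
    (hID : ∀ i j, IsInvariantUnder I (pairLinear S i j))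
    (hIB : ∀ i, IsInvariantUnder I (antiLinearPart (S i)))
    (hdioph : IsDiophantine (eigenvalue S) Set.univ ∨
      (IsProperlyEmbedded I ∧ IsDiophantine (eigenvalue S) (exponentsOff I)))
    (hnonres : IsNonResonantOn S I)
    (hformal : IsFormallyLinearizableOn S I) :
    ∃ Φ Ψ : Fin n → Holo n,
      IsTangentToId (toFormal Φ) ∧ IsTangentToId (toFormal Ψ) ∧
      IsInverse (toFormal Φ) (toFormal Ψ) ∧
      LinearizesGroupOn S I Φ Ψ ∧
      ∀ i, LinearizesInvolutionOn (S i) I Φ Ψ := by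
  set U := idealExponents I with hU
  -- a convergent solution `Ψ` of the linearization equation suffices
  have hlinearize : ∀ Ψ : FormalMap n, IsTangentToId Ψ → (∀ k, IsConvergent (Ψ k)) →
      (∀ i j k, comp (pairMap S i j) Ψ k - comp Ψ (linearMap (pairLinear S i j)) k ∈
        suppIdeal U) →
      ∃ Φ Ψ : Fin n → Holo n,
        IsTangentToId (toFormal Φ) ∧ IsTangentToId (toFormal Ψ) ∧
        IsInverse (toFormal Φ) (toFormal Ψ) ∧
        LinearizesGroupOn S I Φ Ψ ∧
        ∀ i, LinearizesInvolutionOn (S i) I Φ Ψ := by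
    intro Ψ hΨ hΨc hsol
    obtain ⟨Φ, hΦ, hinv⟩ := exists_isInverse hΨ
    have hΦc := isConvergent_inverse hΨ hΦ hΨc hinv.2
    have hΨ0 := hΨ.vanishesAtZero
    have hΦ0 := hΦ.vanishesAtZero
    have hgroup : ∀ g, MemGroup S g → ∀ k,
        MemIdeal I (comp Φ (comp g Ψ) k - linearMap (linearPart g) k) ∧
          comp Φ (comp g Ψ) k - linearMap (linearPart g) k ∈ suppIdeal U := by
      intro g hg k
      obtain ⟨hg0, hgc, -, hgΨ⟩ := hg.linearization hS hdiag hΨ0 hsol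
      have hmem := comp_comp_sub_linearMap_mem hg0 hΨ0 hinv.1 hgΨ k
      refine ⟨memIdeal_of_mem_suppIdeal (IsConvergent.sub ?_ (isConvergent_linearMap _ k)) hmem,
        hmem⟩
      exact (hΦc k).subst (hg0.comp hΨ0) fun l => (hgc l).subst hΨ0 hΨc
    refine ⟨fun k => ⟨Φ k, hΦc k⟩, fun k => ⟨Ψ k, hΨc k⟩, hΦ, hΨ, hinv,
      fun g hg k => (hgroup g hg k).1, fun i k => ?_⟩
    have hS0 := vanishesAtZero_involution hS i
    have hF0 := vanishesAtZero_pairMap hS i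
    have hSΨ0 : VanishesAtZero (comp (toFormal (S i)) (conjMap Ψ)) := hS0.comp hΨ0.conjMap
    have hSΨc : ∀ l, IsConvergent (comp (toFormal (S i)) (conjMap Ψ) l) := fun l =>
      IsConvergent.subst (S i l).2 hΨ0.conjMap fun l => (hΨc l).map_conj
    set T := comp Φ (comp (toFormal (S i)) (conjMap Ψ)) with hT
    have hT0 : VanishesAtZero T := hΦ0.comp hSΨ0
    refine memIdeal_of_mem_suppIdeal (IsConvergent.sub ((hΦc k).subst hSΨ0 hSΨc)
      (isConvergent_linearMap _ k)) ?_
    set H : Fin m → FormalMap n := fun j => comp Φ (comp (pairMap S i j) Ψ) with hH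
    have hmemF : ∀ j, MemGroup S (pairMap S i j) := fun j => by
      have := MemGroup.mul i j (idMap n) (MemGroup.one (S := S))
      rwa [comp_idMap] at this
    have hFΨ0 : ∀ j, VanishesAtZero (comp (pairMap S i j) Ψ) := fun j => (hF0 j).comp hΨ0
    have hH0 : ∀ j, VanishesAtZero (H j) := fun j => hΦ0.comp (hFΨ0 j)
    have hHU : ∀ j l, MemIdeal I (H j l - linearMap (Matrix.diagonal (eigenvalue S (i, j))) l) ∧
        H j l - linearMap (Matrix.diagonal (eigenvalue S (i, j))) l ∈ suppIdeal U := by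
      intro j l
      rw [← pairLinear_eq_diagonal hdiag, ← linearPart_pairMap hS]
      exact hgroup _ (hmemF j) l
    refine sub_linearMap_mem_of_conjugation (T := T) (H := H)
      (μ := fun j => eigenvalue S (i, j)) hT0 ?_ hH0 (fun j => ?_) (fun j => ?_)
      (fun j l => (hHU j l).2) (fun j l => ?_) (fun Q hQ hQ2 l => ?_) k
    · rw [hT, linearPart_comp hΦ0 hSΨ0, linearPart_comp hS0 hΨ0.conjMap, linearPart_conjMap, hΦ.2,
        hΨ.2, Matrix.map_one _ (map_zero _) (map_one _), mul_one, one_mul]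
      rfl
    · -- conjugation by `Ψ` turns `F ∘ ρ ∘ F = ρ` into `H ∘ T ∘ H = T`
      have hc : conjMap (H j) =
          comp (conjMap Φ) (comp (conjMap (pairMap S i j)) (conjMap Ψ)) := by
        rw [hH, conjMap_comp _ (hFΨ0 j), conjMap_comp _ hΨ0]
      have hFc0 : VanishesAtZero (comp (conjMap (pairMap S i j)) (conjMap Ψ)) :=
        (hF0 j).conjMap.comp hΨ0.conjMap
      have hcinv : comp (conjMap Ψ) (conjMap Φ) = idMap n := by
        rw [← conjMap_comp _ hΦ0, hinv.2, conjMap_idMap]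
      have h1 : comp (conjMap Ψ) (conjMap (H j)) =
          comp (conjMap (pairMap S i j)) (conjMap Ψ) := by
        rw [hc, ← comp_assoc _ hΦ0.conjMap hFc0, hcinv, idMap_comp hFc0]
      have hX0 : VanishesAtZero (comp (toFormal (S i)) (comp (conjMap (pairMap S i j))
          (conjMap Ψ))) := hS0.comp hFc0
      have h2 : comp T (conjMap (H j)) =
          comp Φ (comp (toFormal (S i)) (comp (conjMap (pairMap S i j)) (conjMap Ψ))) := by
        rw [hT, comp_assoc _ hSΨ0 (hH0 j).conjMap, comp_assoc _ hΨ0.conjMap (hH0 j).conjMap, h1]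
      rw [h2, hH]
      change comp (comp Φ (comp (pairMap S i j) Ψ)) _ = _
      rw [comp_assoc _ (hFΨ0 j) (hΦ0.comp hX0), comp_assoc _ hΨ0 (hΦ0.comp hX0),
        ← comp_assoc Ψ hΦ0 hX0, hinv.2, idMap_comp hX0,
        ← comp_assoc _ (hF0 j).conjMap hΨ0.conjMap,
        ← comp_assoc _ (hS0.comp (hF0 j).conjMap) hΨ0.conjMap, pairMap_comp_involution_comp hS]
    · rw [hH]
      change linearPart (comp Φ (comp (pairMap S i j) Ψ)) = _
      rw [linearPart_comp hΦ0 (hFΨ0 j), linearPart_comp (hF0 j) hΨ0, hΦ.2, hΨ.2, one_mul, mul_one,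
        linearPart_pairMap hS, pairLinear_eq_diagonal hdiag]
    · obtain ⟨h, hh, hhf⟩ := (hHU j l).1
      obtain ⟨g, hg, hgf⟩ := hIB i h hh
      rw [← hhf, ← hgf]
      exact coe_mem_suppIdeal hI hg
    · obtain ⟨j, hj⟩ := hnonres Q hQ2 hQ i l
      refine ⟨j, fun h => hj (eq_inv_of_mul_eq_one_right h)⟩
  rcases isEmpty_or_nonempty (Fin m) with hm | hm
  · -- without involutions the group is trivial, and non-resonance says nothing
    exact hlinearize (idMap n) ⟨vanishesAtZero_idMap n, linearPart_idMap n⟩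
      (fun k => isConvergent_monomial _ _) fun i => hm.elim i
  · obtain ⟨Ψ, hΨ, hΨU, hsol⟩ := exists_formal_solution hS hdiag hI hformal
    have hμ : IsNonResonantOff (eigenvalue S) U := by
      refine ⟨eigenvalue_ne_zero hS hdiag, fun Q hQ hQ2 k => ?_⟩
      obtain ⟨i⟩ := hm
      obtain ⟨j, hj⟩ := exists_powQ_ne hS hdiag hIB hnonres hQ2 hQ i k
      exact ⟨(i, j), hj⟩
    have hconv : ∀ k, IsConvergent (Ψ k) := by
      rcases hdioph with hd | ⟨-, hd⟩
      · exact isConvergent_of_linearization hm hS hdiag hμ (fun Q _ => Set.mem_univ Q) hd hΨ hΨU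
          hsol
      · exact isConvergent_of_linearization hm hS hdiag hμ (fun Q hQ => hQ) hd hΨ hΨU hsol
    exact hlinearize Ψ hΨ hconv hsol
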